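/- \textbf{Notation.} Let $k$ be a field. For a set $X$, let $X^*$ be the free monoid of words on $X$ (including the empty word $1$) and $k\langle X\rangle$ the free associative algebra, with linear basis $X^*$. Given a strict well order $<$ on $X^*$, $\bar f$ denotes the leading word of $f\in k\langle X\rangle$. For a set $S\subset k\langle X\rangle$ of monic polynomials, a word $w$ and $p\in k\langle X\rangle$, write $p\equiv 0 \bmod (S,w)$ if $p=\sum_i\alpha_i a_is_ib_i$ (a finite sum) with $\alpha_i\in k$, $a_i,b_i\in X^*$, $s_i\in S$ and $\overline{a_is_ib_i}<w$; write $p\equiv q$ for $p-q\equiv 0$. $S$ is a Gröbner–Shirshov basis (GSB) if for all $f,g\in S$ every composition is $\equiv 0\bmod(S,w)$, where the compositions are $(f,g)_w=fb-ag$ for $w=\bar fb=a\bar g$ with $\deg\bar f+\deg\bar g>\deg w$, and $(f,g)_w=f-agb$ for $w=\bar f=a\bar gb$ ($a,b\in X^*$). $\mathrm{sgp}\langle X\mid S\rangle$ is the monoid presented by the generators $X$ and relations $S$; a relation $u=v$ is identified with the polynomial $u-v$. \textbf{Setting.} Let $A,B$ be groups, and let $B=\mathrm{sgp}\langle Y\mid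 R\rangle$, where $Y$ is a well-ordered set and $R=\{f_v=v-h_v\mid v\in\Omega\}$, $\Omega\subseteq Y^*$, $h_v\in Y^*$, is a GSB for the deg-lex order on $Y^*$ with $v$ the leading word of $f_v$, which is minimal: no $v\in\Omega$ is a subword of another $v'\in\Omega$. Some letters of $Y$ may come in pairs $y\neq y^{-1}$ of mutually formally inverse letters. Put $A_1=A\setminus\{1\}$, and fix a well order on $A_1$; the element $1\in A$ is identified with the empty word. The \emph{tower order} on $(A_1\cup Y)^*$ compares words $u_0y_1u_1\cdots y_nu_n$ ($u_i\in A_1^*$, $y_i\in Y$) first by $y_1\cdots y_n$ in the deg-lex order on $Y^*$, and then by $(u_0,u_1,\dots,u_n)$ lexicographically from the left, entries being compared by deg-lex on $A_1^*$. \emph{Extension data} consist of automorphisms $a\mapsto a^y$ of $A$ ($y\in Y$) and a family (factor set) $\{(v)\mid v\in\Omega\}\subseteq A$ with $(v)=1$ whenever $f_v=y^{\varepsilon}y^{-\varepsilon}-1$ for formally inverse letters $y^{\varepsilon},y^{-\varepsilon}$ of $Y$. For such data let $a^u=(\cdots(a^{y_1})\cdots)^{y_n}$ for $u=y_1\cdots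 y_n\in Y^*$, and $$G=E(A,Y,a^y,(v))=\mathrm{sgp}\langle A_1\cup Y\mid S\rangle,\quad S=\{aa'=[aa'],\ v=h_v\cdot(v),\ ay=ya^y\mid a,a'\in A_1,\ v\in\Omega,\ y\in Y\},$$ where $[aa']$ is the product in $A$. For every composition $(f_{v_1},f_{v_2})_w$ of $R$, $w=v_1c=dv_2$, $\deg v_1+\deg v_2>\deg w$, there exist $z\in Y^*$ and $\xi,\zeta\in A$, depending on the composition and on the data, such that $$h_{v_1}c\equiv dh_{v_2}\equiv z \bmod (R,w),\qquad (v_1-h_{v_1}(v_1))c-d(v_2-h_{v_2}(v_2))\equiv z(\xi-\zeta)\bmod (S,w).$$ Fix any choice of these. \textbf{Theorem.} Consider the conditions $$(*)\qquad (v)\,a^{v}=a^{h_v}\,(v)\ \text{ for all } v\in\Omega,\ a\in A,\qquad \xi=\zeta\ \text{ for all compositions of } R.$$ (i) For all extension data, $S$ is a GSB for the tower order if and only if $(*)$ holds in $A$. In this case $G$ is a Schreier extension of $A$ by $B$ in a natural way: $G$ is a group, and there is a short exact sequence $1\to A\to G\to B\to 1$ in which $a\in A$ maps to its class in $G$, and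 the class of $y\in Y$ in $G$ maps to the element of $B$ denoted by $y$. (ii) A group $C$ is a Schreier extension of $A$ by $B$ (i.e. there is a short exact sequence $1\to A\to C\to B\to 1$) if and only if there exist extension data satisfying $(*)$ with $C\cong G=E(A,Y,a^y,(v))$. -/

import Mathlib

noncomputable section

/-! ### Gröbner–Shirshov bases in the free associative algebra `k⟨X⟩` -/

/-- The free associative algebra `k⟨X⟩`: its `k`-basis is the free monoid of words on `X`. -/
abbrev FreeAssoc (k X : Type*) [Field k] : Type _ := MonoidAlgebra k (FreeMonoid X)

/-- A word, seen as a monomial (with coefficient one) of `k⟨X⟩`. -/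
def mono (k : Type*) {X : Type*} [Field k] (u : FreeMonoid X) : FreeAssoc k X :=
  MonoidAlgebra.of k (FreeMonoid X) u

/-- `u` is the leading word of the polynomial `f` for the strict order `r` on words. -/
def IsLeadingWord {k X : Type*} [Field k] (r : FreeMonoid X → FreeMonoid X → Prop)
    (f : FreeAssoc k X) (u : FreeMonoid X) : Prop :=
  f.coeff u ≠ 0 ∧ ∀ t, f.coeff t ≠ 0 → t ≠ u → r t u

/-- `p ≡ 0 mod (S, w)`: `p` is a finite sum `∑ αᵢ aᵢ sᵢ bᵢ` with `αᵢ ∈ k`, `sᵢ ∈ S`, words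
`aᵢ, bᵢ`, and leading words of the `aᵢ sᵢ bᵢ` smaller than `w`. -/
def IsTrivialMod {k X : Type*} [Field k] (r : FreeMonoid X → FreeMonoid X → Prop)
    (S : Set (FreeAssoc k X)) (w : FreeMonoid X) (p : FreeAssoc k X) : Prop :=
  p ∈ Submodule.span k
    {q : FreeAssoc k X | ∃ s ∈ S, ∃ a b t : FreeMonoid X,
      q = mono k a * s * mono k b ∧ IsLeadingWord r q t ∧ r t w}

/-- `S` is a Gröbner–Shirshov basis in `k⟨X⟩`: its elements are monic, and all intersection and
inclusion compositions of its elements are trivial. -/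
structure IsGSB {k X : Type*} [Field k] (r : FreeMonoid X → FreeMonoid X → Prop)
    (S : Set (FreeAssoc k X)) : Prop where
  monic : ∀ f ∈ S, ∃ u, IsLeadingWord r f u ∧ f.coeff u = 1
  intersection : ∀ f ∈ S, ∀ g ∈ S, ∀ u v, IsLeadingWord r f u → IsLeadingWord r g v →
    ∀ w a b : FreeMonoid X, w = u * b → w = a * v → w.length < u.length + v.length →
      IsTrivialMod r S w (f * mono k b - mono k a * g)
  inclusion : ∀ f ∈ S, ∀ g ∈ S, ∀ u v, IsLeadingWord r f u → IsLeadingWord r g v →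
    ∀ a b : FreeMonoid X, u = a * v * b →
      IsTrivialMod r S u (f - mono k a * g * mono k b)

/-- The binomials `u - v` attached to defining relations `u = v` of a semigroup presentation. -/
def binomials (k : Type*) {X : Type*} [Field k] (rel : FreeMonoid X → FreeMonoid X → Prop) :
    Set (FreeAssoc k X) :=
  {f | ∃ u v, rel u v ∧ f = mono k u - mono k v}

/-! ### Word orders -/

/-- The (strict) deg-lex order on words. -/
def DegLexLT {X : Type*} (r : X → X → Prop) (u v : FreeMonoid X) : Prop :=
  List.Shortlex r u.toList v.toList

/-- The word in `Y` obtained from a word in `X ∪ Y` by erasing the letters from `X`. -/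
def yPart {X Y : Type*} : List (X ⊕ Y) → List Y
  | [] => []
  | Sum.inl _ :: w => yPart w
  | Sum.inr y :: w => y :: yPart w

/-- The blocks `u₀, u₁, …, uₙ ∈ X*` of a word `u₀ y₁ u₁ ⋯ yₙ uₙ` with `yᵢ ∈ Y`. -/
def xBlocks {X Y : Type*} : List (X ⊕ Y) → List (List X)
  | [] => [[]]
  | Sum.inl x :: w =>
      match xBlocks w with
      | [] => [[x]]
      | u :: us => (x :: u) :: us
  | Sum.inr _ :: w => [] :: xBlocks w

/-- The (strict) tower order on words in `X ∪ Y`: words `u₀ y₁ u₁ ⋯ yₙ uₙ` are compared first by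
`y₁ ⋯ yₙ` in the deg-lex order on `Y*`, then by `(u₀, …, uₙ)` lexicographically from the left, the
entries being compared in the deg-lex order on `X*`. -/
def TowerLT {X Y : Type*} (rX : X → X → Prop) (rY : Y → Y → Prop)
    (u v : FreeMonoid (X ⊕ Y)) : Prop :=
  Prod.Lex (List.Shortlex rY) (List.Lex (List.Shortlex rX))
    (yPart u.toList, xBlocks u.toList) (yPart v.toList, xBlocks v.toList)

/-! ### The presentation `sgp⟨Y | R⟩` and the extension data -/

/-- The relations `v = h_v`, `v ∈ Ω`. -/
def RRel {Y : Type*} (Ω : Set (FreeMonoid Y)) (h : Ω → FreeMonoid Y)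
    (u w : FreeMonoid Y) : Prop :=
  ∃ v : Ω, u = v ∧ w = h v

/-- `A₁ = A \ {1}`. -/
abbrev NonOne (A : Type*) [Group A] : Type _ := {a : A // a ≠ 1}

/-- The element `a` of `A` as a word in `A₁ ∪ Y`: the letter `a` if `a ≠ 1`, the empty word if
`a = 1`. -/
def aWord {A : Type*} [Group A] (Y : Type*) (a : A) : FreeMonoid (NonOne A ⊕ Y) :=
  open Classical in
  if ha : a = 1 then 1 else FreeMonoid.of (Sum.inl ⟨a, ha⟩)

/-- A word in `Y` as a word in `A₁ ∪ Y`. -/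
def yWord (A : Type*) [Group A] {Y : Type*} (u : FreeMonoid Y) : FreeMonoid (NonOne A ⊕ Y) :=
  FreeMonoid.map Sum.inr u

/-- Automorphisms `a ↦ a^y` of `A` for `y ∈ Y`, and a factor set `{(v) | v ∈ Ω} ⊆ A`, with
`(v) = 1` whenever the relation `v = h_v` has the form `y y⁻¹ = 1`; here `inv y = some y'` says
that the letter `y'` is the formal inverse `y⁻¹` of the letter `y`, and letters may also have no
formal inverse in `Y`. -/
structure ExtData (A : Type*) [Group A] {Y : Type*} (inv : Y → Option Y)
    (Ω : Set (FreeMonoid Y)) (h : Ω → FreeMonoid Y) where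
  act : Y → MulAut A
  factor : Ω → A
  factor_eq_one : ∀ (v : Ω) (y y' : Y), inv y = some y' →
    (v : FreeMonoid Y) = FreeMonoid.of y * FreeMonoid.of y' → h v = 1 → factor v = 1

namespace ExtData

variable {A : Type*} [Group A] {Y : Type*} {inv : Y → Option Y} {Ω : Set (FreeMonoid Y)}
  {h : Ω → FreeMonoid Y} (D : ExtData A inv Ω h)

/-- `a^u = (⋯((a^{y₁})^{y₂})⋯)^{yₙ}` for a word `u = y₁ ⋯ yₙ` in `Y`. -/
def pow (a : A) (u : FreeMonoid Y) : A :=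
  u.toList.foldl (fun b y => D.act y b) a

/-- The relations `S` of `E(A, Y, a^y, (v))`. -/
inductive SRel : FreeMonoid (NonOne A ⊕ Y) → FreeMonoid (NonOne A ⊕ Y) → Prop
  | mul (a a' : NonOne A) :
      SRel (FreeMonoid.of (Sum.inl a) * FreeMonoid.of (Sum.inl a')) (aWord Y (a.1 * a'.1))
  | factor (v : Ω) :
      SRel (yWord A (v : FreeMonoid Y)) (yWord A (h v) * aWord Y (D.factor v))
  | comm (a : NonOne A) (y : Y) :
      SRel (FreeMonoid.of (Sum.inl a) * FreeMonoid.of (Sum.inr y))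
        (FreeMonoid.of (Sum.inr y) * aWord Y (D.act y a.1))

/-- `G = E(A, Y, a^y, (v)) = sgp⟨A₁ ∪ Y | S⟩`. -/
abbrev E : Type _ := PresentedMonoid D.SRel

end ExtData

/-- A composition `(f_{v₁}, f_{v₂})_w` of `R`, `w = v₁ c = d v₂`, `deg v₁ + deg v₂ > deg w`. -/
structure Overlap {Y : Type*} (Ω : Set (FreeMonoid Y)) where
  v₁ : Ω
  v₂ : Ω
  c : FreeMonoid Y
  d : FreeMonoid Y
  eq : (v₁ : FreeMonoid Y) * c = d * v₂
  overlap : ((v₁ : FreeMonoid Y) * c).length <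
    (v₁ : FreeMonoid Y).length + (v₂ : FreeMonoid Y).length

/-- The word `w` of a composition. -/
def Overlap.w {Y : Type*} {Ω : Set (FreeMonoid Y)} (o : Overlap Ω) : FreeMonoid Y :=
  (o.v₁ : FreeMonoid Y) * o.c

namespace ExtData

variable {A : Type*} [Group A] {Y : Type*} {inv : Y → Option Y} {Ω : Set (FreeMonoid Y)}
  {h : Ω → FreeMonoid Y} (D : ExtData A inv Ω h)

/-- The composition `g = (v₁ - h_{v₁}·(v₁), v₂ - h_{v₂}·(v₂))_w` in `k⟨A₁ ∪ Y⟩`. -/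
def comp (k : Type*) [Field k] (o : Overlap Ω) : FreeAssoc k (NonOne A ⊕ Y) :=
  (mono k (yWord A (o.v₁ : FreeMonoid Y))
      - mono k (yWord A (h o.v₁) * aWord Y (D.factor o.v₁))) * mono k (yWord A o.c)
    - mono k (yWord A o.d) * (mono k (yWord A (o.v₂ : FreeMonoid Y))
      - mono k (yWord A (h o.v₂) * aWord Y (D.factor o.v₂)))

/-- A choice, for every composition of `R`, of a word `z ∈ Y*` with
`h_{v₁} c ≡ d h_{v₂} ≡ z mod (R, w)` and of elements `ξ, ζ ∈ A` with
`g ≡ z (ξ - ζ) mod (S, w)`. -/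
structure XiZeta (k : Type*) [Field k] (rA : NonOne A → NonOne A → Prop) (rY : Y → Y → Prop)
    (D : ExtData A inv Ω h) where
  z : Overlap Ω → FreeMonoid Y
  ξ : Overlap Ω → A
  ζ : Overlap Ω → A
  left : ∀ o, IsTrivialMod (DegLexLT rY) (binomials k (RRel Ω h)) o.w
    (mono k (h o.v₁ * o.c) - mono k (z o))
  right : ∀ o, IsTrivialMod (DegLexLT rY) (binomials k (RRel Ω h)) o.w
    (mono k (o.d * h o.v₂) - mono k (z o))
  comp : ∀ o, IsTrivialMod (TowerLT rA rY) (binomials k D.SRel) (yWord A o.w)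
    (D.comp k o - mono k (yWord A (z o)) * (mono k (aWord Y (ξ o)) - mono k (aWord Y (ζ o))))

/-- The conditions `(v) a^v = a^{h_v} (v)` for all `v ∈ Ω`, `a ∈ A`, and `ξ = ζ` for all
compositions of `R`. -/
def Cond {k : Type*} [Field k] {rA : NonOne A → NonOne A → Prop} {rY : Y → Y → Prop}
    (T : D.XiZeta k rA rY) : Prop :=
  (∀ (v : Ω) (a : A), D.factor v * D.pow a v = D.pow a (h v) * D.factor v) ∧
    ∀ o : Overlap Ω, T.ξ o = T.ζ o

/-- `G` is a Schreier extension of `A` by `B` in the natural way: `G` is a group, and there is a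
short exact sequence `1 → A → G → B → 1` whose maps send `a ∈ A` to its class in `G` and the class
of a letter `y ∈ Y` to the element `e y` of `B` that `y` denotes. -/
def IsNaturalExtension {B : Type*} [Group B] (e : PresentedMonoid (RRel Ω h) ≃* B) : Prop :=
  ∃ hG : ∀ g : D.E, IsUnit g,
    letI : Group D.E := groupOfIsUnit hG
    ∃ X : GroupExtension A D.E B,
      (∀ a : A, X.inl a = PresentedMonoid.mk D.SRel (aWord Y a)) ∧
      ∀ y : Y, X.rightHom (PresentedMonoid.of D.SRel (Sum.inr y)) =
        e (PresentedMonoid.of (RRel Ω h) y)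

end ExtData

end

/-! All relations are binomials, so the theory becomes rewriting of words. A polynomial trivial
modulo `(S, w)` is killed by the linear extension of every map on words that is constant along
rewriting steps from words below `w` (`IsTrivialMod.wordMap_eq_zero`); conversely, two words below
`w` with a common reduct have trivial difference (`isTrivialMod_of_join`). By well-founded
induction, a Gröbner–Shirshov basis of binomials gives a normal form, so distinct irreducible words
stay distinct in the presented monoid (`IsGSB.eq_of_mk_eq`).

Elements of `A` move to the right past letters of `Y`. For all data, `z ξ = z ζ` and `h_v (v) a^v =
v a^v = a v = h_v a^{h_v} (v)` hold in `G`, so `(*)` follows once words `z` can be cancelled in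
front of elements of `A` (`cond_of_cancel`). If `S` is a Gröbner–Shirshov basis, they can: `z`
equals some `n α` with `n` irreducible for `R`, and the words `n a` are irreducible for `S`
(`cancel_of_isGSB`). Conversely, `(*)` settles the critical pairs (`isGSB_of_cond`): its first half
those on `a v`, its second half the overlaps of `R`. Those on `a a' a''` and `a a' y` are settled by
associativity and by multiplicativity of `a ↦ a^y`.

Words equal in `B` differ in `G` by an element of `A`. Hence `G` is always a group and `A → G → B →
1` is always exact; only injectivity of `A → G` uses the Gröbner–Shirshov property. Given an
extension `C`, representatives of the letters define extension data with `G ≅ C` (`exists_extData`).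
Cancellation is then inherited from the group `C`, so `(*)` holds for every choice of `ξ` and `ζ`.
-/

/-! ### Rewriting with binomials -/

section Rewriting

variable {k X : Type*} [Field k] {r : FreeMonoid X → FreeMonoid X → Prop}
  {rel : FreeMonoid X → FreeMonoid X → Prop}

/-- A well-founded strict order on words, compatible with multiplication. -/
structure IsMonomialOrder (r : FreeMonoid X → FreeMonoid X → Prop) : Prop where
  wf : WellFounded r
  trans : ∀ {u v w}, r u v → r v w → r u w
  mul_left : ∀ {u v} (a), r u v → r (a * u) (a * v)
  mul_right : ∀ {u v} (a), r u v → r (u * a) (v * a)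

theorem IsMonomialOrder.irrefl (hr : IsMonomialOrder r) (u : FreeMonoid X) : ¬ r u u :=
  fun hu => hr.wf.asymmetric _ _ hu hu

theorem IsMonomialOrder.ne (hr : IsMonomialOrder r) {u v : FreeMonoid X} (huv : r u v) : u ≠ v :=
  fun he => hr.irrefl v (he ▸ huv)

theorem IsMonomialOrder.mul_mul (hr : IsMonomialOrder r) {u v : FreeMonoid X} (a b : FreeMonoid X)
    (huv : r u v) : r (a * u * b) (a * v * b) :=
  hr.mul_right b (hr.mul_left a huv)

theorem mono_mul (a b : FreeMonoid X) : mono k (a * b) = mono k a * mono k b :=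
  map_mul _ _ _

theorem mono_coeff (u t : FreeMonoid X) [Decidable (u = t)] :
    (mono k u).coeff t = if u = t then 1 else 0 := by
  classical
  simp only [mono, MonoidAlgebra.of_apply, MonoidAlgebra.coeff_single]
  rw [Finsupp.single_apply]

/-- The linear map on `k⟨X⟩` that extends a map defined on words. -/
noncomputable def wordMap (k : Type*) [Field k] {N : Type*} (f : FreeMonoid X → N) :
    FreeAssoc k X →ₗ[k] (N →₀ k) where
  toFun p := Finsupp.mapDomain f p.coeff
  map_add' p q := by simp [Finsupp.mapDomain_add]
  map_smul' c p := by simp [Finsupp.mapDomain_smul]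

theorem wordMap_mono {N : Type*} (f : FreeMonoid X → N) (u : FreeMonoid X) :
    wordMap k f (mono k u) = Finsupp.single (f u) 1 := by
  simp [wordMap, mono]

theorem isLeadingWord_binomial {u v : FreeMonoid X} (hne : v ≠ u) (huv : r v u) :
    IsLeadingWord r (mono k u - mono k v) u ∧ (mono k u - mono k v).coeff u = 1 := by
  classical
  have h1 : (mono k u - mono k v).coeff u = 1 := by
    simp [mono_coeff, hne]
  refine ⟨⟨by rw [h1]; exact one_ne_zero, fun t ht htu => ?_⟩, h1⟩
  by_cases hvt : v = t
  · exact hvt ▸ huv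
  · simp [mono_coeff, hvt, Ne.symm htu] at ht

theorem IsLeadingWord.unique (hr : IsMonomialOrder r) {f : FreeAssoc k X} {u v : FreeMonoid X}
    (hu : IsLeadingWord r f u) (hv : IsLeadingWord r f v) : u = v := by
  by_contra hne
  exact hr.wf.asymmetric _ _ (hu.2 v hv.1 (Ne.symm hne)) (hv.2 u hu.1 hne)

theorem isLeadingWord_binomial_iff (hr : IsMonomialOrder r) {u v t : FreeMonoid X}
    (huv : r v u) : IsLeadingWord r (mono k u - mono k v) t ↔ t = u := by
  have hu := (isLeadingWord_binomial (k := k) (hr.ne huv) huv).1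
  constructor
  · exact fun ht => ht.unique hr hu
  · rintro rfl
    exact hu

theorem mono_mul_binomial_mul (a u v b : FreeMonoid X) :
    mono k a * (mono k u - mono k v) * mono k b = mono k (a * u * b) - mono k (a * v * b) := by
  simp only [mono_mul, mul_sub, sub_mul]

/-- Compatibility of the order with multiplication makes `a u b` the leading word of `a (u - v) b`,
so leading words can be eliminated from the definition. -/
theorem isTrivialMod_binomials_iff (hr : IsMonomialOrder r) (hrel : ∀ {u v}, rel u v → r v u)
    {w : FreeMonoid X} {p : FreeAssoc k X} :
    IsTrivialMod r (binomials k rel) w p ↔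
      p ∈ Submodule.span k {q : FreeAssoc k X | ∃ u v a b, rel u v ∧ r (a * u * b) w ∧
        q = mono k (a * u * b) - mono k (a * v * b)} := by
  unfold IsTrivialMod
  have : {q : FreeAssoc k X | ∃ s ∈ binomials k rel, ∃ a b t : FreeMonoid X,
      q = mono k a * s * mono k b ∧ IsLeadingWord r q t ∧ r t w} =
      {q : FreeAssoc k X | ∃ u v a b, rel u v ∧ r (a * u * b) w ∧
        q = mono k (a * u * b) - mono k (a * v * b)} := by
    ext q
    constructor
    · rintro ⟨s, ⟨u, v, huv, rfl⟩, a, b, t, hq, ht, htw⟩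
      rw [mono_mul_binomial_mul] at hq
      rw [hq, isLeadingWord_binomial_iff hr (hr.mul_mul a b (hrel huv))] at ht
      exact ⟨u, v, a, b, huv, ht ▸ htw, hq⟩
    · rintro ⟨u, v, a, b, huv, hw, rfl⟩
      exact ⟨_, ⟨u, v, huv, rfl⟩, a, b, a * u * b, (mono_mul_binomial_mul a u v b).symm,
        (isLeadingWord_binomial_iff hr (hr.mul_mul a b (hrel huv))).2 rfl, hw⟩
  rw [this]

/-- This is how information is extracted from triviality: each spanning binomial is one rewriting
step below `w`, which `f` does not see. -/
theorem IsTrivialMod.wordMap_eq_zero (hr : IsMonomialOrder r) (hrel : ∀ {u v}, rel u v → r v u)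
    {N : Type*} (f : FreeMonoid X → N) {w : FreeMonoid X} {p : FreeAssoc k X}
    (hf : ∀ u v a b, rel u v → r (a * u * b) w → f (a * u * b) = f (a * v * b))
    (hp : IsTrivialMod r (binomials k rel) w p) : wordMap k f p = 0 := by
  rw [isTrivialMod_binomials_iff hr hrel] at hp
  suffices Submodule.span k _ ≤ LinearMap.ker (wordMap k f) from this hp
  rw [Submodule.span_le]
  rintro q ⟨u, v, a, b, huv, hw, rfl⟩
  simp [wordMap_mono, hf u v a b huv hw]

theorem single_one_inj {N : Type*} {m n : N}
    (he : (Finsupp.single m 1 : N →₀ k) - Finsupp.single n 1 = 0) : m = n :=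
  Finsupp.single_left_injective one_ne_zero (sub_eq_zero.1 he)

theorem IsTrivialMod.apply_eq (hr : IsMonomialOrder r) (hrel : ∀ {u v}, rel u v → r v u)
    {N : Type*} (f : FreeMonoid X → N) {w m n : FreeMonoid X}
    (hf : ∀ u v a b, rel u v → r (a * u * b) w → f (a * u * b) = f (a * v * b))
    (hp : IsTrivialMod r (binomials k rel) w (mono k m - mono k n)) : f m = f n := by
  have := hp.wordMap_eq_zero hr hrel f hf
  rw [map_sub, wordMap_mono, wordMap_mono] at this
  exact single_one_inj this

theorem IsTrivialMod.zero {S : Set (FreeAssoc k X)} {w : FreeMonoid X} :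
    IsTrivialMod r S w 0 :=
  Submodule.zero_mem _

theorem IsTrivialMod.add {S : Set (FreeAssoc k X)} {w : FreeMonoid X} {p q : FreeAssoc k X}
    (hp : IsTrivialMod r S w p) (hq : IsTrivialMod r S w q) : IsTrivialMod r S w (p + q) :=
  Submodule.add_mem _ hp hq

theorem IsTrivialMod.neg {S : Set (FreeAssoc k X)} {w : FreeMonoid X} {p : FreeAssoc k X}
    (hp : IsTrivialMod r S w p) : IsTrivialMod r S w (-p) :=
  Submodule.neg_mem _ hp

theorem IsTrivialMod.symm {S : Set (FreeAssoc k X)} {w : FreeMonoid X} {p q : FreeAssoc k X}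
    (hp : IsTrivialMod r S w (p - q)) : IsTrivialMod r S w (q - p) := by
  simpa using hp.neg

theorem IsTrivialMod.trans {S : Set (FreeAssoc k X)} {w : FreeMonoid X} {p q s : FreeAssoc k X}
    (hp : IsTrivialMod r S w (p - q)) (hq : IsTrivialMod r S w (q - s)) :
    IsTrivialMod r S w (p - s) := by
  simpa using hp.add hq

theorem IsTrivialMod.mul_mul (hr : IsMonomialOrder r) (hrel : ∀ {u v}, rel u v → r v u)
    {w : FreeMonoid X} {p : FreeAssoc k X} (hp : IsTrivialMod r (binomials k rel) w p)
    (a b : FreeMonoid X) :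
    IsTrivialMod r (binomials k rel) (a * w * b) (mono k a * p * mono k b) := by
  rw [isTrivialMod_binomials_iff hr hrel] at hp ⊢
  induction hp using Submodule.span_induction with
  | mem q hq =>
    obtain ⟨u, v, c, d, huv, hw, rfl⟩ := hq
    refine Submodule.subset_span ⟨u, v, a * c, d * b, huv, ?_, ?_⟩
    · simpa only [mul_assoc] using hr.mul_mul a b hw
    · rw [mono_mul_binomial_mul]
      simp only [mul_assoc]
  | zero => simp
  | add p q _ _ hp hq => simpa only [mul_add, add_mul] using Submodule.add_mem _ hp hq
  | smul c p _ hp => simpa using Submodule.smul_mem _ c hp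

/-- One step of the rewriting system with rules `u → v`, `rel u v`. -/
def RewriteStep (rel : FreeMonoid X → FreeMonoid X → Prop) (m n : FreeMonoid X) : Prop :=
  ∃ u v a b, rel u v ∧ m = a * u * b ∧ n = a * v * b

/-- Rewriting in finitely many steps. -/
def Rewrites (rel : FreeMonoid X → FreeMonoid X → Prop) : FreeMonoid X → FreeMonoid X → Prop :=
  Relation.ReflTransGen (RewriteStep rel)

theorem RewriteStep.lt (hr : IsMonomialOrder r) (hrel : ∀ {u v}, rel u v → r v u)
    {m n : FreeMonoid X} (hmn : RewriteStep rel m n) : r n m := by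
  obtain ⟨u, v, a, b, huv, rfl, rfl⟩ := hmn
  exact hr.mul_mul a b (hrel huv)

theorem RewriteStep.mul_mul {m n : FreeMonoid X} (hmn : RewriteStep rel m n)
    (a b : FreeMonoid X) : RewriteStep rel (a * m * b) (a * n * b) := by
  obtain ⟨u, v, c, d, huv, rfl, rfl⟩ := hmn
  exact ⟨u, v, a * c, d * b, huv, by simp only [mul_assoc], by simp only [mul_assoc]⟩

theorem Rewrites.refl (m : FreeMonoid X) : Rewrites rel m m := Relation.ReflTransGen.refl

theorem Rewrites.trans {m n p : FreeMonoid X} (hmn : Rewrites rel m n) (hnp : Rewrites rel n p) :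
    Rewrites rel m p :=
  Relation.ReflTransGen.trans hmn hnp

theorem Rewrites.of_rel {u v : FreeMonoid X} (huv : rel u v) : Rewrites rel u v :=
  Relation.ReflTransGen.single ⟨u, v, 1, 1, huv, by simp, by simp⟩

theorem Rewrites.mul_mul {m n : FreeMonoid X} (hmn : Rewrites rel m n) (a b : FreeMonoid X) :
    Rewrites rel (a * m * b) (a * n * b) :=
  Relation.ReflTransGen.lift (fun m => a * m * b) (fun _ _ hs => RewriteStep.mul_mul hs a b) _ _ hmn

theorem Rewrites.mul_left {m n : FreeMonoid X} (hmn : Rewrites rel m n) (a : FreeMonoid X) :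
    Rewrites rel (a * m) (a * n) := by
  simpa using hmn.mul_mul a 1

theorem Rewrites.mul_right {m n : FreeMonoid X} (hmn : Rewrites rel m n) (b : FreeMonoid X) :
    Rewrites rel (m * b) (n * b) := by
  simpa using hmn.mul_mul 1 b

theorem Rewrites.mk_eq {m n : FreeMonoid X} (hmn : Rewrites rel m n) :
    PresentedMonoid.mk rel m = PresentedMonoid.mk rel n := by
  induction hmn with
  | refl => rfl
  | tail _ hs ih =>
    obtain ⟨u, v, a, b, huv, rfl, rfl⟩ := hs
    rw [ih, map_mul, map_mul, map_mul, map_mul, PresentedMonoid.mk_eq_mk_of_rel huv]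

theorem Rewrites.eq_or_lt (hr : IsMonomialOrder r) (hrel : ∀ {u v}, rel u v → r v u)
    {m n : FreeMonoid X} (hmn : Rewrites rel m n) : n = m ∨ r n m := by
  induction hmn with
  | refl => exact Or.inl rfl
  | tail _ hs ih =>
    rcases ih with rfl | ih
    · exact Or.inr (hs.lt hr hrel)
    · exact Or.inr (hr.trans (hs.lt hr hrel) ih)

theorem Rewrites.isTrivialMod (hr : IsMonomialOrder r) (hrel : ∀ {u v}, rel u v → r v u)
    {m n w : FreeMonoid X} (hmn : Rewrites rel m n) (hm : r m w) :
    IsTrivialMod r (binomials k rel) w (mono k m - mono k n) := by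
  induction hmn with
  | refl => simpa using IsTrivialMod.zero
  | tail hmb hs ih =>
    refine ih.trans ?_
    have hb : r _ w := (Rewrites.eq_or_lt hr hrel hmb).elim
      (fun he => he ▸ hm) (fun hlt => hr.trans hlt hm)
    obtain ⟨u, v, a, b, huv, rfl, rfl⟩ := hs
    rw [isTrivialMod_binomials_iff hr hrel]
    exact Submodule.subset_span ⟨u, v, a, b, huv, hb, rfl⟩

/-- A pair of words below `w` with a common reduct has trivial difference modulo `w`. -/
theorem isTrivialMod_of_join (hr : IsMonomialOrder r) (hrel : ∀ {u v}, rel u v → r v u)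
    {m n p w : FreeMonoid X} (hm : Rewrites rel m p) (hn : Rewrites rel n p)
    (hmw : r m w) (hnw : r n w) :
    IsTrivialMod r (binomials k rel) w (mono k m - mono k n) :=
  (hm.isTrivialMod hr hrel hmw).trans (hn.isTrivialMod hr hrel hnw).symm

/-! ### Normal forms for Gröbner–Shirshov bases of binomials -/

theorem FreeMonoid.mul_eq_mul_iff_exists {a b c d : FreeMonoid X} :
    a * b = c * d ↔ (∃ p, c = a * p ∧ b = p * d) ∨ ∃ p, a = c * p ∧ d = p * b :=
  List.append_eq_append_iff

theorem FreeMonoid.overlap_of_mul_eq_mul {u v a b : FreeMonoid X} (he : u * b = a * v)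
    (hl : (u * b).length < u.length + v.length) :
    ∃ c, c ≠ 1 ∧ u = a * c ∧ v = c * b := by
  rcases FreeMonoid.mul_eq_mul_iff_exists.1 he with ⟨p, rfl, rfl⟩ | ⟨p, hu, hv⟩
  · simp only [FreeMonoid.length_mul] at hl
    omega
  · refine ⟨p, ?_, hu, hv⟩
    rintro rfl
    subst hu hv
    simp at hl

/-- Any two one-step reducts of a word are identified by every map on words that is constant along
rewriting steps below that word. -/
theorem IsGSB.apply_eq_of_reducts (hr : IsMonomialOrder r) (hrel : ∀ {u v}, rel u v → r v u)
    (hS : IsGSB r (binomials k rel)) {N : Type*} (f : FreeMonoid X → N) {w : FreeMonoid X}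
    (hf : ∀ m, r m w → ∀ n, RewriteStep rel m n → f m = f n)
    {u₁ v₁ a₁ b₁ u₂ v₂ a₂ b₂ : FreeMonoid X} (h₁ : rel u₁ v₁) (h₂ : rel u₂ v₂)
    (hw₁ : w = a₁ * u₁ * b₁) (hw₂ : w = a₂ * u₂ * b₂) :
    f (a₁ * v₁ * b₁) = f (a₂ * v₂ * b₂) := by
  wlog hl : a₁.length ≤ a₂.length generalizing u₁ v₁ a₁ b₁ u₂ v₂ a₂ b₂
  · exact (this h₂ h₁ hw₂ hw₁ (le_of_not_ge hl)).symm
  have lead {u v : FreeMonoid X} (huv : rel u v) : IsLeadingWord r (mono k u - mono k v) u :=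
    (isLeadingWord_binomial_iff hr (hrel huv)).2 rfl
  have hf' : ∀ u v a b, rel u v → r (a * u * b) w → f (a * u * b) = f (a * v * b) :=
    fun u v a b huv hlt => hf _ hlt _ ⟨u, v, a, b, huv, rfl, rfl⟩
  have he : a₁ * (u₁ * b₁) = a₂ * (u₂ * b₂) := by
    rw [← mul_assoc, ← mul_assoc, ← hw₁, ← hw₂]
  obtain ⟨p, rfl, hp⟩ : ∃ p, a₂ = a₁ * p ∧ u₁ * b₁ = p * (u₂ * b₂) := by
    rcases FreeMonoid.mul_eq_mul_iff_exists.1 he with hp | ⟨p, rfl, hp⟩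
    · exact hp
    · have : p = 1 := FreeMonoid.length_eq_zero.1 (by
        rw [FreeMonoid.length_mul] at hl
        omega)
      subst this
      exact ⟨1, by simp, by simpa using hp.symm⟩
  -- Disjoint occurrences commute: each one-step reduct lies below `w`, and rewriting the other
  -- occurrence leads from both to the same word.
  have disjoint {q : FreeMonoid X} (hpq : p = u₁ * q) (hb : b₁ = q * (u₂ * b₂)) :
      f (a₁ * v₁ * b₁) = f (a₁ * p * v₂ * b₂) := by
    have e1 := hf' u₂ v₂ (a₁ * v₁ * q) b₂ h₂ (by
      rw [hw₂, hpq]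
      simpa only [mul_assoc] using hr.mul_mul a₁ (q * u₂ * b₂) (hrel h₁))
    have e2 := hf' u₁ v₁ a₁ (q * v₂ * b₂) h₁ (by
      rw [hw₂, hpq]
      simpa only [mul_assoc] using hr.mul_mul (a₁ * u₁ * q) b₂ (hrel h₂))
    rw [hb, hpq]
    simp only [mul_assoc] at e1 e2 ⊢
    rw [e1, e2]
  rcases FreeMonoid.mul_eq_mul_iff_exists.1 hp with ⟨q, hpq, hb⟩ | ⟨c, hu, hc⟩
  · exact disjoint hpq hb
  rcases FreeMonoid.mul_eq_mul_iff_exists.1 hc with ⟨q, rfl, hb⟩ | ⟨q, hu2, hb⟩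
  · have hu' : u₁ = p * u₂ * q := by rw [hu, mul_assoc]
    have key := hS.inclusion _ ⟨u₁, v₁, h₁, rfl⟩ _ ⟨u₂, v₂, h₂, rfl⟩ u₁ u₂ (lead h₁) (lead h₂)
      p q hu'
    have e : (mono k u₁ - mono k v₁) - mono k p * (mono k u₂ - mono k v₂) * mono k q =
        mono k (p * v₂ * q) - mono k v₁ := by
      rw [mono_mul_binomial_mul, ← hu']
      abel
    rw [e] at key
    have key' := key.mul_mul hr hrel a₁ b₁
    rw [mono_mul_binomial_mul, ← hw₁] at key'
    have := key'.apply_eq hr hrel f hf'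
    rw [← this, hb]
    simp only [mul_assoc]
  -- Intersection compositions require a nonempty overlap; occurrences that merely touch count as
  -- disjoint.
  · by_cases hc1 : c = 1
    · subst hc1
      exact disjoint (q := 1) (by simpa using hu.symm) (by rw [hb, hu2]; simp)
    have hcpos : 0 < c.length := Nat.pos_of_ne_zero (by simpa using hc1)
    have key := hS.intersection _ ⟨u₁, v₁, h₁, rfl⟩ _ ⟨u₂, v₂, h₂, rfl⟩ u₁ u₂ (lead h₁) (lead h₂)
      (u₁ * q) p q rfl (by rw [hu, hu2, mul_assoc]) (by
        simp only [hu, hu2, FreeMonoid.length_mul]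
        omega)
    have e : (mono k u₁ - mono k v₁) * mono k q - mono k p * (mono k u₂ - mono k v₂) =
        mono k (p * v₂) - mono k (v₁ * q) := by
      rw [sub_mul, mul_sub, ← mono_mul, ← mono_mul, ← mono_mul, ← mono_mul, hu, hu2, mul_assoc]
      abel
    rw [e] at key
    have key' := key.mul_mul hr hrel a₁ b₂
    have hw' : a₁ * (u₁ * q) * b₂ = w := by
      rw [hw₁, hb]
      simp only [mul_assoc]
    rw [mono_mul_binomial_mul, hw'] at key'
    have := key'.apply_eq hr hrel f hf'
    simp only [hb, mul_assoc] at this ⊢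
    exact this.symm

/-- For a Gröbner–Shirshov basis of binomials, rewriting steps preserve a normal form. -/
theorem IsGSB.exists_normalForm (hr : IsMonomialOrder r) (hrel : ∀ {u v}, rel u v → r v u)
    (hS : IsGSB r (binomials k rel)) :
    ∃ N : FreeMonoid X → FreeMonoid X, (∀ m n, RewriteStep rel m n → N m = N n) ∧
      ∀ m, (∀ n, ¬ RewriteStep rel m n) → N m = m := by
  classical
  -- Follow an arbitrarily chosen step until none is possible; the induction below shows that the
  -- choice is immaterial.
  let N : FreeMonoid X → FreeMonoid X := hr.wf.fix fun m ih =>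
    if hm : ∃ n, RewriteStep rel m n then ih hm.choose (hm.choose_spec.lt hr hrel) else m
  have N_eq (m) : N m = if hm : ∃ n, RewriteStep rel m n then N hm.choose else m :=
    hr.wf.fix_eq _ _
  refine ⟨N, fun m => ?_, fun m hm => ?_⟩
  · induction m using hr.wf.induction with
    | _ m ih =>
      intro n hmn
      have hex : ∃ n, RewriteStep rel m n := ⟨n, hmn⟩
      rw [N_eq m, dif_pos hex]
      obtain ⟨u₁, v₁, a₁, b₁, h₁, hm₁, hn₁⟩ := hex.choose_spec
      obtain ⟨u₂, v₂, a₂, b₂, h₂, hm₂, rfl⟩ := hmn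
      rw [hn₁]
      exact hS.apply_eq_of_reducts hr hrel N ih h₁ h₂ hm₁ hm₂
  · rw [N_eq m, dif_neg (by simpa using hm)]

/-- For a Gröbner–Shirshov basis of binomials, equal irreducible words in the presented monoid
are equal. -/
theorem IsGSB.eq_of_mk_eq (hr : IsMonomialOrder r) (hrel : ∀ {u v}, rel u v → r v u)
    (hS : IsGSB r (binomials k rel)) {m n : FreeMonoid X}
    (hm : ∀ p, ¬ RewriteStep rel m p) (hn : ∀ p, ¬ RewriteStep rel n p)
    (hmn : PresentedMonoid.mk rel m = PresentedMonoid.mk rel n) : m = n := by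
  obtain ⟨N, hN, hirr⟩ := hS.exists_normalForm hr hrel
  -- Quantifying over contexts makes equality of normal forms a congruence, which then contains the
  -- one generated by `rel`.
  let c : Con (FreeMonoid X) :=
    { r := fun m n => ∀ a b, N (a * m * b) = N (a * n * b)
      iseqv := ⟨fun _ _ _ => rfl, fun h a b => (h a b).symm,
        fun h h' a b => (h a b).trans (h' a b)⟩
      mul' := fun {p q s t} h h' a b => by
        have e1 := h a (s * b)
        have e2 := h' (a * q) b
        simp only [mul_assoc] at e1 e2 ⊢
        rw [e1, e2] }
  have hle : conGen rel ≤ c := Con.conGen_le.2 fun u v huv a b =>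
    hN _ _ ⟨u, v, a, b, huv, rfl, rfl⟩
  have h1 := hle (PresentedMonoid.mk_eq_mk_iff.1 hmn) 1 1
  simp only [one_mul, mul_one] at h1
  rw [← hirr m hm, ← hirr n hn, h1]

end Rewriting

/-! ### The deg-lex and tower orders are monomial orders -/

section Orders

variable {X Y : Type*}

theorem List.Lex.trans_of_trans {r : X → X → Prop} (hr : ∀ a b c, r a b → r b c → r a c) :
    ∀ {s t u : List X}, List.Lex r s t → List.Lex r t u → List.Lex r s u
  | _, _, _, .nil, .rel _ => .nil
  | _, _, _, .nil, .cons _ => .nil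
  | _, _, _, .rel h, .rel h' => .rel (hr _ _ _ h h')
  | _, _, _, .rel h, .cons _ => .rel h
  | _, _, _, .cons _, .rel h' => .rel h'
  | _, _, _, .cons h, .cons h' => .cons (trans_of_trans hr h h')

theorem List.Shortlex.trans_of_trans {r : X → X → Prop}
    (hr : ∀ a b c, r a b → r b c → r a c) {s t u : List X}
    (hst : List.Shortlex r s t) (htu : List.Shortlex r t u) : List.Shortlex r s u := by
  rw [List.shortlex_def] at *
  rcases hst with h1 | ⟨h1, h1'⟩ <;> rcases htu with h2 | ⟨h2, h2'⟩
  · exact Or.inl (h1.trans h2)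
  · exact Or.inl (h2 ▸ h1)
  · exact Or.inl (h1 ▸ h2)
  · exact Or.inr ⟨h1.trans h2, h1'.trans_of_trans hr h2'⟩

/-- Equal lengths exclude a proper prefix, for which appending on the right could reverse the order.
-/
theorem List.Lex.append_append {r : X → X → Prop} {s t : List X} (hst : List.Lex r s t)
    (hl : s.length = t.length) (u : List X) : List.Lex r (s ++ u) (t ++ u) := by
  induction hst with
  | nil => simp at hl
  | rel h => exact .rel h
  | cons _ ih => exact .cons (ih (by simpa using hl))

theorem List.Shortlex.append_append {r : X → X → Prop} {s t : List X}
    (hst : List.Shortlex r s t) (u : List X) : List.Shortlex r (s ++ u) (t ++ u) := by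
  rcases List.shortlex_def.1 hst with h | ⟨h, h'⟩
  · exact .of_length_lt (by simpa using h)
  · exact .of_lex (by simpa using h) (h'.append_append h u)

theorem isMonomialOrder_degLexLT (rY : Y → Y → Prop) [IsWellOrder Y rY] :
    IsMonomialOrder (DegLexLT rY) where
  wf := InvImage.wf _ (List.Shortlex.wf IsWellFounded.wf)
  trans := List.Shortlex.trans_of_trans fun _ _ _ h h' => _root_.trans h h'
  mul_left a h := List.Shortlex.append_left h a.toList
  mul_right a h := List.Shortlex.append_append h a.toList

/-! ### The `Y`-part and the blocks of a concatenation -/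

theorem yPart_append (u v : List (X ⊕ Y)) : yPart (u ++ v) = yPart u ++ yPart v := by
  induction u with
  | nil => rfl
  | cons x u ih => cases x <;> simp [yPart, ih]

theorem yPart_map_inr (u : List Y) : yPart (u.map (Sum.inr : Y → X ⊕ Y)) = u := by
  induction u with
  | nil => rfl
  | cons y u ih => simp [yPart, ih]

theorem xBlocks_ne_nil (u : List (X ⊕ Y)) : xBlocks u ≠ [] := by
  cases u with
  | nil => simp [xBlocks]
  | cons x u =>
    cases x
    · simp only [xBlocks]
      split <;> simp
    · simp [xBlocks]

theorem length_xBlocks (u : List (X ⊕ Y)) : (xBlocks u).length = (yPart u).length + 1 := by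
  induction u with
  | nil => rfl
  | cons x u ih =>
    cases x
    · simp only [xBlocks, yPart]
      split <;> simp_all
    · simp [xBlocks, yPart, ih]

/-- Concatenation of block lists, in which the last block of the first list is merged with the
first block of the second one. -/
def glueBlocks : List (List X) → List (List X) → List (List X)
  -- The cases involving an empty list are default values: the block list of a word is never empty.
  | [], c => c
  | [b], [] => [b]
  | [b], c :: cs => (b ++ c) :: cs
  | b :: b' :: bs, c => b :: glueBlocks (b' :: bs) c

theorem glueBlocks_nil_cons (c : List (List X)) (hc : c ≠ []) : glueBlocks [[]] c = c := by
  cases c with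
  | nil => exact absurd rfl hc
  | cons c cs => rfl

theorem glueBlocks_cons_cons (x : X) (b : List X) (bs c : List (List X)) (hc : c ≠ []) :
    ∃ d ds, glueBlocks (b :: bs) c = d :: ds ∧
      glueBlocks ((x :: b) :: bs) c = (x :: d) :: ds := by
  cases bs with
  | nil =>
    cases c with
    | nil => exact absurd rfl hc
    | cons c cs => exact ⟨_, _, rfl, rfl⟩
  | cons b' bs => exact ⟨_, _, rfl, rfl⟩

theorem xBlocks_append (u v : List (X ⊕ Y)) :
    xBlocks (u ++ v) = glueBlocks (xBlocks u) (xBlocks v) := by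
  induction u with
  | nil => exact (glueBlocks_nil_cons _ (xBlocks_ne_nil v)).symm
  | cons x u ih =>
    obtain ⟨b, bs, hb⟩ := List.exists_cons_of_ne_nil (xBlocks_ne_nil u)
    cases x with
    | inl x =>
      obtain ⟨d, ds, h1, h2⟩ := glueBlocks_cons_cons x b bs _ (xBlocks_ne_nil v)
      simp only [List.cons_append, xBlocks, ih, hb, h1, h2]
    | inr y => simp [xBlocks, ih, hb, glueBlocks]

/-- With equally many blocks on both sides, the last blocks are merged with the head of `c`
simultaneously, and deg-lex survives appending a common word. -/
theorem glueBlocks_lex_right {r : X → X → Prop} {p q : List (List X)}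
    (hpq : List.Lex (List.Shortlex r) p q) (hl : p.length = q.length) (c : List (List X)) :
    List.Lex (List.Shortlex r) (glueBlocks p c) (glueBlocks q c) := by
  induction hpq with
  | nil => simp at hl
  | @rel b bs b' bs' h =>
    cases bs with
    | nil =>
      obtain rfl : bs' = [] := List.length_eq_zero_iff.1 (by simpa using hl.symm)
      cases c with
      | nil => exact .rel h
      | cons c cs => exact .rel (h.append_append c)
    | cons d ds =>
      obtain ⟨d', ds', rfl⟩ := List.exists_cons_of_ne_nil (l := bs') (by rintro rfl; simp at hl)
      exact .rel h
  | @cons b bs bs' h ih =>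
    have hl' : bs.length = bs'.length := by simpa using hl
    cases h with
    | nil => simp at hl'
    | rel h => exact .cons (ih hl')
    | cons h => exact .cons (ih hl')

theorem glueBlocks_lex_left {r : X → X → Prop} {p q : List (List X)}
    (hpq : List.Lex (List.Shortlex r) p q) (hl : p.length = q.length) :
    ∀ c : List (List X), List.Lex (List.Shortlex r) (glueBlocks c p) (glueBlocks c q)
  | [] => hpq
  | [b] => by
    cases hpq with
    | nil => simp at hl
    | rel h => exact .rel (h.append_left b)
    | cons h => exact .cons h
  | _ :: b' :: bs => .cons (glueBlocks_lex_left hpq hl (b' :: bs))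

variable {rX : X → X → Prop} {rY : Y → Y → Prop}

theorem towerLT_iff {u v : FreeMonoid (X ⊕ Y)} : TowerLT rX rY u v ↔
    List.Shortlex rY (yPart u.toList) (yPart v.toList) ∨
      yPart u.toList = yPart v.toList ∧
        List.Lex (List.Shortlex rX) (xBlocks u.toList) (xBlocks v.toList) :=
  Prod.lex_def

/-- A plain lexicographic order on lists need not be well-founded. Words with equal `Y`-parts have
equally many blocks, however, so the second comparison is contained in a well-founded shortlex
order. -/
theorem TowerLT.wf (hX : WellFounded rX) (hY : WellFounded rY) :
    WellFounded (TowerLT rX rY) := by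
  refine Subrelation.wf ?_ (InvImage.wf
    (fun u : FreeMonoid (X ⊕ Y) => (yPart u.toList, xBlocks u.toList))
    (WellFounded.prod_lex (List.Shortlex.wf hY) (List.Shortlex.wf (List.Shortlex.wf hX))))
  intro u v huv
  rcases towerLT_iff.1 huv with h | ⟨h, h'⟩
  · exact Prod.lex_def.2 (Or.inl h)
  · exact Prod.lex_def.2 (Or.inr ⟨h, .of_lex (by rw [length_xBlocks, length_xBlocks, h]) h'⟩)

theorem isMonomialOrder_towerLT (rX : X → X → Prop) (rY : Y → Y → Prop) [IsWellOrder X rX]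
    [IsWellOrder Y rY] : IsMonomialOrder (TowerLT rX rY) where
  wf := TowerLT.wf IsWellFounded.wf IsWellFounded.wf
  trans {u v w} huv hvw := by
    have tX (s t p : List X) : List.Shortlex rX s t → List.Shortlex rX t p → List.Shortlex rX s p :=
      List.Shortlex.trans_of_trans fun _ _ _ h h' => _root_.trans h h'
    have tY {s t p : List Y} : List.Shortlex rY s t → List.Shortlex rY t p → List.Shortlex rY s p :=
      List.Shortlex.trans_of_trans fun _ _ _ h h' => _root_.trans h h'
    rw [towerLT_iff] at *
    rcases huv with h1 | ⟨h1, h1'⟩ <;> rcases hvw with h2 | ⟨h2, h2'⟩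
    · exact Or.inl (tY h1 h2)
    · exact Or.inl (h2 ▸ h1)
    · exact Or.inl (h1 ▸ h2)
    · exact Or.inr ⟨h1.trans h2, h1'.trans_of_trans tX h2'⟩
  mul_left {u v} a huv := by
    rw [towerLT_iff] at *
    simp only [FreeMonoid.toList_mul, yPart_append, xBlocks_append]
    rcases huv with h | ⟨h, h'⟩
    · exact Or.inl (h.append_left _)
    · exact Or.inr ⟨by rw [h],
        glueBlocks_lex_left h' (by rw [length_xBlocks, length_xBlocks, h]) _⟩
  mul_right {u v} a huv := by
    rw [towerLT_iff] at *
    simp only [FreeMonoid.toList_mul, yPart_append, xBlocks_append]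
    rcases huv with h | ⟨h, h'⟩
    · exact Or.inl (h.append_append _)
    · exact Or.inr ⟨by rw [h],
        glueBlocks_lex_right h' (by rw [length_xBlocks, length_xBlocks, h]) _⟩

end Orders

/-! ### Words of `E(A, Y, a^y, (v))` -/

section Words

variable {A : Type*} [Group A] {Y : Type*}

theorem aWord_one : aWord Y (1 : A) = 1 := by simp [aWord]

theorem aWord_coe (a : NonOne A) : aWord Y a.1 = FreeMonoid.of (Sum.inl a) := by
  simp [aWord, a.2]

theorem aWord_of_ne {a : A} (ha : a ≠ 1) : aWord Y a = FreeMonoid.of (Sum.inl ⟨a, ha⟩) :=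
  aWord_coe ⟨a, ha⟩

theorem aWord_injective : Function.Injective (aWord Y : A → FreeMonoid (NonOne A ⊕ Y)) := by
  intro a b hab
  by_cases ha : a = 1 <;> by_cases hb : b = 1
  · rw [ha, hb]
  · rw [ha, aWord_one, aWord_of_ne hb] at hab
    exact absurd hab (FreeMonoid.one_ne_of _)
  · rw [hb, aWord_one, aWord_of_ne ha] at hab
    exact absurd hab (FreeMonoid.of_ne_one _)
  · rw [aWord_of_ne ha, aWord_of_ne hb] at hab
    simpa using FreeMonoid.of_injective hab

theorem yWord_one : yWord A (1 : FreeMonoid Y) = 1 := map_one _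

theorem yWord_mul (u v : FreeMonoid Y) : yWord A (u * v) = yWord A u * yWord A v := map_mul _ _ _

theorem yWord_of (y : Y) : yWord A (FreeMonoid.of y) = FreeMonoid.of (Sum.inr y) := rfl

theorem yPart_yWord (u : FreeMonoid Y) : yPart (yWord A u).toList = u.toList :=
  yPart_map_inr _

theorem yWord_injective : Function.Injective (yWord A : FreeMonoid Y → _) := fun u v huv => by
  rw [← FreeMonoid.toList.injective.eq_iff, ← yPart_yWord (A := A) u, huv, yPart_yWord]

theorem yPart_aWord (a : A) : yPart (aWord Y a).toList = [] := by
  by_cases ha : a = 1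
  · rw [ha, aWord_one]
    rfl
  · rw [aWord_of_ne ha]
    rfl

theorem length_aWord_le (a : A) : (aWord Y a).toList.length ≤ 1 := by
  by_cases ha : a = 1
  · simp [ha, aWord_one]
  · simp [aWord_of_ne ha]

end Words

/-! ### Basic rewritings with the relations `S` -/

namespace ExtData

variable {A : Type*} [Group A] {Y : Type*} {inv : Y → Option Y} {Ω : Set (FreeMonoid Y)}
  {h : Ω → FreeMonoid Y} (D : ExtData A inv Ω h)

theorem pow_word_one (a : A) : D.pow a 1 = a := rfl

theorem pow_of (a : A) (y : Y) : D.pow a (FreeMonoid.of y) = D.act y a := rfl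

theorem pow_mul (a : A) (u v : FreeMonoid Y) : D.pow a (u * v) = D.pow (D.pow a u) v := by
  simp [pow]

theorem rewrites_mul (a b : A) :
    Rewrites D.SRel (aWord Y a * aWord Y b) (aWord Y (a * b)) := by
  by_cases ha : a = 1
  · simpa [ha, aWord_one] using Rewrites.refl _
  by_cases hb : b = 1
  · simpa [hb, aWord_one] using Rewrites.refl _
  rw [aWord_of_ne ha, aWord_of_ne hb]
  exact .of_rel (.mul ⟨a, ha⟩ ⟨b, hb⟩)

theorem rewrites_comm (a : A) (y : Y) :
    Rewrites D.SRel (aWord Y a * FreeMonoid.of (Sum.inr y))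
      (FreeMonoid.of (Sum.inr y) * aWord Y (D.act y a)) := by
  by_cases ha : a = 1
  · simpa [ha, aWord_one] using Rewrites.refl _
  rw [aWord_of_ne ha]
  exact .of_rel (.comm ⟨a, ha⟩ y)

theorem rewrites_push (a : A) (u : FreeMonoid Y) :
    Rewrites D.SRel (aWord Y a * yWord A u) (yWord A u * aWord Y (D.pow a u)) := by
  induction u using FreeMonoid.inductionOn' generalizing a with
  | one => simpa [yWord_one, pow_word_one] using Rewrites.refl _
  | of_mul y u ih =>
    rw [yWord_mul, yWord_of, pow_mul, pow_of]
    have h1 := (D.rewrites_comm a y).mul_right (yWord A u)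
    have h2 := (ih (D.act y a)).mul_left (FreeMonoid.of (Sum.inr y))
    rw [← mul_assoc, mul_assoc (FreeMonoid.of _) (yWord A u)]
    exact h1.trans (by simpa only [mul_assoc] using h2)

theorem rewrites_factor (v : Ω) :
    Rewrites D.SRel (yWord A (v : FreeMonoid Y)) (yWord A (h v) * aWord Y (D.factor v)) :=
  .of_rel (.factor v)

/-- Rewriting an occurrence of `v` in a word in `Y` and moving the factor to the right end. -/
theorem rewrites_context (v : Ω) (a b : FreeMonoid Y) (β : A) :
    Rewrites D.SRel (yWord A (a * (v : FreeMonoid Y) * b) * aWord Y β)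
      (yWord A (a * h v * b) * aWord Y (D.pow (D.factor v) b * β)) := by
  have h1 := (D.rewrites_factor v).mul_mul (yWord A a) (yWord A b * aWord Y β)
  have h2 := (D.rewrites_push (D.factor v) b).mul_mul (yWord A (a * h v)) (aWord Y β)
  have h3 := (D.rewrites_mul (D.pow (D.factor v) b) β).mul_left (yWord A (a * h v * b))
  simp only [yWord_mul, mul_assoc] at h1 h2 h3 ⊢
  exact (h1.trans h2).trans h3

variable {rA : NonOne A → NonOne A → Prop} {rY : Y → Y → Prop}

/-- A product shortens the only block, and a factor relation lowers the `Y`-part. Commutation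
empties the block before `y`, which decides before the block after `y` is looked at. -/
theorem SRel.lt (h_lt : ∀ v : Ω, DegLexLT rY (h v) v) {u v : FreeMonoid (NonOne A ⊕ Y)}
    (huv : D.SRel u v) : TowerLT rA rY v u := by
  rw [towerLT_iff]
  cases huv with
  | mul a a' =>
    refine Or.inr ⟨by rw [yPart_aWord]; rfl, ?_⟩
    have : List.Lex (List.Shortlex rA) (xBlocks (aWord Y (a.1 * a'.1)).toList) [[a, a']] := by
      by_cases haa : a.1 * a'.1 = 1
      · rw [haa, aWord_one]
        exact .rel (.of_length_lt (by simp))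
      · rw [aWord_of_ne haa]
        exact .rel (.of_length_lt (by simp))
    exact this
  | factor v =>
    left
    rw [FreeMonoid.toList_mul, yPart_append, yPart_aWord, yPart_yWord, yPart_yWord,
      List.append_nil]
    exact h_lt v
  | comm a y =>
    right
    constructor
    · rw [FreeMonoid.toList_mul, yPart_append, yPart_aWord]
      rfl
    · exact .rel (.of_length_lt (by simp))

end ExtData

/-! ### Subwords of words in `A₁ ∪ Y` -/

section Subwords

variable {A : Type*} [Group A] {X Y : Type*}

theorem FreeMonoid.of_eq_mul {x : X} {a b : FreeMonoid X} (he : FreeMonoid.of x = a * b) :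
    a = 1 ∧ b = FreeMonoid.of x ∨ a = FreeMonoid.of x ∧ b = 1 :=
  List.singleton_eq_append_iff.1 he

theorem FreeMonoid.of_mul_of_eq_mul {x y : X} {a c : FreeMonoid X}
    (he : FreeMonoid.of x * FreeMonoid.of y = a * c) :
    a = 1 ∧ c = FreeMonoid.of x * FreeMonoid.of y ∨ a = FreeMonoid.of x ∧ c = FreeMonoid.of y ∨
      a = FreeMonoid.of x * FreeMonoid.of y ∧ c = 1 := by
  rcases FreeMonoid.mul_eq_mul_iff_exists.1 he with ⟨p, rfl, hp⟩ | ⟨p, hp, rfl⟩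
  · rcases FreeMonoid.of_eq_mul hp with ⟨rfl, rfl⟩ | ⟨rfl, rfl⟩
    · exact Or.inr (Or.inl ⟨mul_one _, rfl⟩)
    · exact Or.inr (Or.inr ⟨rfl, rfl⟩)
  · rcases FreeMonoid.of_eq_mul hp with ⟨rfl, rfl⟩ | ⟨rfl, rfl⟩
    · exact Or.inl ⟨rfl, rfl⟩
    · exact Or.inr (Or.inl ⟨rfl, one_mul _⟩)

theorem FreeMonoid.of_mul_of_inj {x y x' y' : X}
    (he : FreeMonoid.of x * FreeMonoid.of y = FreeMonoid.of x' * FreeMonoid.of y') :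
    x = x' ∧ y = y' := by
  have : [x, y] = [x', y'] := he
  simpa using this

theorem FreeMonoid.of_ne_of_mul_of (x x' y' : X) :
    FreeMonoid.of x ≠ FreeMonoid.of x' * FreeMonoid.of y' :=
  fun he => by simpa using congrArg FreeMonoid.length he

/-- The overlaps of two words of length two. -/
theorem FreeMonoid.overlap_of_mul_of {x y x' y' : X} {a b c : FreeMonoid X} (hc : c ≠ 1)
    (h₁ : FreeMonoid.of x * FreeMonoid.of y = a * c)
    (h₂ : FreeMonoid.of x' * FreeMonoid.of y' = c * b) :
    a = 1 ∧ b = 1 ∧ x = x' ∧ y = y' ∨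
      a = FreeMonoid.of x ∧ b = FreeMonoid.of y' ∧ y = x' := by
  rcases FreeMonoid.of_mul_of_eq_mul h₁ with ⟨rfl, hc₁⟩ | ⟨rfl, hc₁⟩ | ⟨_, hc₁⟩
  · rcases FreeMonoid.of_mul_of_eq_mul h₂ with ⟨hc₂, _⟩ | ⟨hc₂, _⟩ | ⟨hc₂, rfl⟩
    · exact absurd hc₂ hc
    · exact absurd (hc₂.symm.trans hc₁) (FreeMonoid.of_ne_of_mul_of _ _ _)
    · exact Or.inl ⟨rfl, rfl, FreeMonoid.of_mul_of_inj (hc₁.symm.trans hc₂)⟩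
  · rcases FreeMonoid.of_mul_of_eq_mul h₂ with ⟨hc₂, _⟩ | ⟨hc₂, rfl⟩ | ⟨hc₂, _⟩
    · exact absurd hc₂ hc
    · exact Or.inr ⟨rfl, rfl, FreeMonoid.of_injective (hc₁.symm.trans hc₂)⟩
    · exact absurd (hc₁.symm.trans hc₂) (FreeMonoid.of_ne_of_mul_of _ _ _)
  · exact absurd hc₁ hc

theorem FreeMonoid.eq_one_of_length_eq {a v b u : FreeMonoid X} (he : u = a * v * b)
    (hl : u.length = v.length) : a = 1 ∧ b = 1 := by
  rw [he, FreeMonoid.length_mul, FreeMonoid.length_mul] at hl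
  exact ⟨FreeMonoid.length_eq_zero.1 (by omega), FreeMonoid.length_eq_zero.1 (by omega)⟩

theorem inl_notMem_yWord (a : NonOne A) (u : FreeMonoid Y) : Sum.inl a ∉ yWord A u := by
  simp [yWord, FreeMonoid.mem_map]

theorem inr_mem_yWord {u : FreeMonoid Y} (hu : u ≠ 1) : ∃ y, (Sum.inr y) ∈ yWord A u := by
  induction u using FreeMonoid.inductionOn' with
  | one => exact absurd rfl hu
  | of_mul y u _ => exact ⟨y, by rw [yWord_mul, yWord_of]; simp [FreeMonoid.mem_mul]⟩

theorem yWord_eq_mul {v : FreeMonoid Y} {a b : FreeMonoid (NonOne A ⊕ Y)}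
    (he : yWord A v = a * b) :
    ∃ a' b' : FreeMonoid Y, v = a' * b' ∧ a = yWord A a' ∧ b = yWord A b' := by
  obtain ⟨a', b', h1, h2, h3⟩ := List.map_eq_append_iff.1 he
  exact ⟨a', b', h1, h2.symm, h3.symm⟩

/-- In a word `n · a` with `n ∈ Y*` and `a ∈ A`, no letter follows a letter from `A₁`. -/
theorem eq_one_of_yWord_mul_aWord_eq {n : FreeMonoid Y} {α : A} {p q : FreeMonoid (NonOne A ⊕ Y)}
    {a : NonOne A} (he : yWord A n * aWord Y α = p * (FreeMonoid.of (Sum.inl a) * q)) : q = 1 := by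
  rcases FreeMonoid.mul_eq_mul_iff_exists.1 he with ⟨t, _, ht⟩ | ⟨t, ht, _⟩
  · have hl := length_aWord_le (Y := Y) α
    rw [ht] at hl
    simp only [FreeMonoid.toList_mul, FreeMonoid.toList_of, List.length_append,
      List.length_cons, List.length_nil] at hl
    exact FreeMonoid.length_eq_zero.1 (by unfold FreeMonoid.length; omega)
  · rename_i h2
    rcases FreeMonoid.mul_eq_mul_iff_exists.1 h2 with ⟨s, rfl, _⟩ | ⟨s, h3, h4⟩
    · exact absurd (by rw [ht]; simp [FreeMonoid.mem_mul]) (inl_notMem_yWord a n)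
    · rcases FreeMonoid.of_eq_mul h3 with ⟨_, rfl⟩ | ⟨rfl, _⟩
      · have hl := length_aWord_le (Y := Y) α
        rw [h4] at hl
        change List.length (Sum.inl a :: q.toList) ≤ 1 at hl
        exact FreeMonoid.length_eq_zero.1 (by
          rw [List.length_cons] at hl
          unfold FreeMonoid.length
          omega)
      · exact absurd (by rw [ht]; exact List.mem_append_right _ (List.mem_singleton_self _))
          (inl_notMem_yWord a n)

end Subwords

namespace ExtData

variable {k : Type*} [Field k] {A : Type*} [Group A] {Y : Type*} {inv : Y → Option Y}
  {Ω : Set (FreeMonoid Y)} {h : Ω → FreeMonoid Y} (D : ExtData A inv Ω h)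
  {rA : NonOne A → NonOne A → Prop} {rY : Y → Y → Prop}

theorem RRel_lt (h_lt : ∀ v : Ω, DegLexLT rY (h v) v) {u v : FreeMonoid Y}
    (huv : RRel Ω h u v) : DegLexLT rY v u := by
  obtain ⟨v, rfl, rfl⟩ := huv
  exact h_lt v

theorem relator_ne_one (h_lt : ∀ v : Ω, DegLexLT rY (h v) v) (v : Ω) : (v : FreeMonoid Y) ≠ 1 := by
  intro hv
  have := h_lt v
  rw [hv] at this
  exact List.not_shortlex_nil_right this

/-! ### Identities in `G` -/

theorem mk_aWord_mul (a b : A) : PresentedMonoid.mk D.SRel (aWord Y (a * b)) =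
    PresentedMonoid.mk D.SRel (aWord Y a) * PresentedMonoid.mk D.SRel (aWord Y b) := by
  rw [← (D.rewrites_mul a b).mk_eq, map_mul]

theorem mk_aWord_mul_yWord (a : A) (u : FreeMonoid Y) :
    PresentedMonoid.mk D.SRel (aWord Y a) * PresentedMonoid.mk D.SRel (yWord A u) =
      PresentedMonoid.mk D.SRel (yWord A u) * PresentedMonoid.mk D.SRel (aWord Y (D.pow a u)) := by
  rw [← map_mul, (D.rewrites_push a u).mk_eq, map_mul]

theorem mk_relator (v : Ω) : PresentedMonoid.mk D.SRel (yWord A (v : FreeMonoid Y)) =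
    PresentedMonoid.mk D.SRel (yWord A (h v)) *
      PresentedMonoid.mk D.SRel (aWord Y (D.factor v)) := by
  rw [(D.rewrites_factor v).mk_eq, map_mul]

/-! ### Existence of `ξ` and `ζ` -/

/-- The two copies of the word `w` cancel, leaving the difference of its two reducts. -/
theorem comp_eq (o : Overlap Ω) : D.comp k o =
    mono k (yWord A (o.d * h o.v₂) * aWord Y (D.factor o.v₂)) -
      mono k (yWord A (h o.v₁) * aWord Y (D.factor o.v₁) * yWord A o.c) := by
  have e : mono k (yWord A (o.v₁ : FreeMonoid Y)) * mono k (yWord A o.c) =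
      mono k (yWord A o.d) * mono k (yWord A (o.v₂ : FreeMonoid Y)) := by
    rw [← mono_mul, ← yWord_mul, o.eq, yWord_mul, mono_mul]
  rw [comp, sub_mul, mul_sub, e, ← mono_mul _ (yWord A o.c), yWord_mul, mul_assoc (yWord A o.d),
    mono_mul (yWord A o.d)]
  abel

theorem towerLT_of_yWord_lt {u w : FreeMonoid Y} (huw : DegLexLT rY u w) (α : A) :
    TowerLT rA rY (yWord A u * aWord Y α) (yWord A w) := by
  rw [towerLT_iff, FreeMonoid.toList_mul, yPart_append, yPart_aWord, yPart_yWord, yPart_yWord,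
    List.append_nil]
  exact Or.inl huw

variable [IsWellOrder (NonOne A) rA] [IsWellOrder Y rY]

/-- A congruence modulo `(R, w)` between words in `Y` lifts to a congruence modulo `(S, w)`, up to
an element of `A`. -/
theorem exists_lift_isTrivialMod (h_lt : ∀ v : Ω, DegLexLT rY (h v) v) {u u' w : FreeMonoid Y}
    (hu : IsTrivialMod (DegLexLT rY) (binomials k (RRel Ω h)) w (mono k u - mono k u')) :
    ∃ α : A, ∀ β : A, IsTrivialMod (TowerLT rA rY) (binomials k D.SRel) (yWord A w)
      (mono k (yWord A u * aWord Y β) - mono k (yWord A u' * aWord Y (α * β))) := by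
  -- Being linked by some `α` is an equivalence relation because `α` works for all `β` at once. The
  -- quotient map is constant along `R`-steps below `w`, so `IsTrivialMod.apply_eq` applies to it.
  let s : Setoid (FreeMonoid Y) :=
    { r := fun u u' => ∃ α : A, ∀ β : A,
        IsTrivialMod (TowerLT rA rY) (binomials k D.SRel) (yWord A w)
          (mono k (yWord A u * aWord Y β) - mono k (yWord A u' * aWord Y (α * β)))
      iseqv := by
        refine ⟨fun u => ⟨1, fun β => ?_⟩, ?_, ?_⟩
        · simpa using IsTrivialMod.zero
        · rintro u u' ⟨α, hα⟩
          refine ⟨α⁻¹, fun β => ?_⟩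
          simpa using (hα (α⁻¹ * β)).symm
        · rintro u u' u'' ⟨α, hα⟩ ⟨α', hα'⟩
          refine ⟨α' * α, fun β => ?_⟩
          rw [mul_assoc]
          exact (hα β).trans (hα' (α * β)) }
  have := hu.apply_eq (isMonomialOrder_degLexLT rY) (RRel_lt h_lt) (Quotient.mk s) (by
    rintro _ _ a b ⟨v, rfl, rfl⟩ hlt
    exact Quotient.sound ⟨D.pow (D.factor v) b, fun β => (D.rewrites_context v a b β).isTrivialMod
      (isMonomialOrder_towerLT rA rY) (SRel.lt D h_lt) (towerLT_of_yWord_lt hlt β)⟩)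
  exact Quotient.exact this

theorem nonempty_xiZeta (h_lt : ∀ v : Ω, DegLexLT rY (h v) v)
    (h_gsb : IsGSB (DegLexLT rY) (binomials k (RRel Ω h))) : Nonempty (D.XiZeta k rA rY) := by
  have hY := isMonomialOrder_degLexLT rY
  have triv (o : Overlap Ω) : IsTrivialMod (DegLexLT rY) (binomials k (RRel Ω h)) o.w
      (mono k (o.d * h o.v₂) - mono k (h o.v₁ * o.c)) := by
    have lead (v : Ω) : IsLeadingWord (DegLexLT rY)
        (mono k (v : FreeMonoid Y) - mono k (h v)) v :=
      (isLeadingWord_binomial_iff hY (h_lt v)).2 rfl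
    have := h_gsb.intersection _ ⟨_, _, ⟨o.v₁, rfl, rfl⟩, rfl⟩ _ ⟨_, _, ⟨o.v₂, rfl, rfl⟩, rfl⟩
      _ _ (lead _) (lead _) o.w o.d o.c rfl o.eq o.overlap
    convert this using 1
    rw [sub_mul, mul_sub, ← mono_mul, ← mono_mul, ← mono_mul, ← mono_mul, o.eq]
    abel
  choose α hα using fun o => D.exists_lift_isTrivialMod (rA := rA) h_lt (triv o)
  -- With `z = d h_{v₂}` the first reduct is `z (v₂)` on the nose. The lift sends `z β` to `h_{v₁} c
  -- α β`, so `ζ = α⁻¹ (v₁)^c` is what turns `z ζ` into `h_{v₁} c (v₁)^c`, a rewriting of `h_{v₁}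
  -- (v₁) c`.
  refine ⟨⟨fun o => o.d * h o.v₂, fun o => D.factor o.v₂,
    fun o => (α o)⁻¹ * D.pow (D.factor o.v₁) o.c, fun o => (triv o).symm,
    fun o => by simpa using IsTrivialMod.zero, fun o => ?_⟩⟩
  have h1 := hα o ((α o)⁻¹ * D.pow (D.factor o.v₁) o.c)
  rw [mul_inv_cancel_left] at h1
  have h2 := (D.rewrites_push (D.factor o.v₁) o.c).mul_left (yWord A (h o.v₁))
  rw [← mul_assoc, ← mul_assoc, ← yWord_mul] at h2
  have h3 := h2.isTrivialMod (k := k) (w := yWord A o.w) (isMonomialOrder_towerLT rA rY)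
    (SRel.lt D h_lt) (by
      rw [towerLT_iff, FreeMonoid.toList_mul, FreeMonoid.toList_mul, yPart_append, yPart_append,
        yPart_aWord, yPart_yWord, yPart_yWord, yPart_yWord, List.append_nil]
      exact Or.inl (hY.mul_right o.c (h_lt o.v₁)))
  convert h1.trans h3.symm using 1
  rw [comp_eq, mul_sub, ← mono_mul, ← mono_mul]
  abel

/-! ### Cancellation in `G` and the necessity of `(*)` -/

theorem XiZeta.mk_eq {D : ExtData A inv Ω h} (h_lt : ∀ v : Ω, DegLexLT rY (h v) v)
    (T : D.XiZeta k rA rY) (o : Overlap Ω) :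
    PresentedMonoid.mk D.SRel (yWord A (T.z o) * aWord Y (T.ξ o)) =
      PresentedMonoid.mk D.SRel (yWord A (T.z o) * aWord Y (T.ζ o)) := by
  have h0 := (T.comp o).wordMap_eq_zero (isMonomialOrder_towerLT rA rY) (SRel.lt D h_lt)
    (PresentedMonoid.mk D.SRel) (fun u v a b huv _ => by
      simp only [map_mul, PresentedMonoid.mk_eq_mk_of_rel huv])
  -- Both reducts represent the class of `w` in `G`, so the composition contributes nothing there,
  -- whatever the data.
  have e : PresentedMonoid.mk D.SRel (yWord A (o.d * h o.v₂) * aWord Y (D.factor o.v₂)) =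
      PresentedMonoid.mk D.SRel
        (yWord A (h o.v₁) * aWord Y (D.factor o.v₁) * yWord A o.c) := by
    rw [yWord_mul, map_mul, map_mul, map_mul, map_mul, mul_assoc, ← mk_relator, ← mk_relator,
      ← map_mul, ← map_mul, ← yWord_mul, ← yWord_mul, o.eq]
  rw [comp_eq, mul_sub, ← mono_mul, ← mono_mul, map_sub, map_sub, map_sub, wordMap_mono,
    wordMap_mono, wordMap_mono, wordMap_mono, e, sub_self, zero_sub, neg_eq_zero] at h0
  exact single_one_inj h0

/-- The conditions `(*)` hold as soon as `z ξ = z ζ` in `G` implies `ξ = ζ`. -/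
theorem cond_of_cancel (h_lt : ∀ v : Ω, DegLexLT rY (h v) v) (T : D.XiZeta k rA rY)
    (hc : ∀ (z : FreeMonoid Y) (ξ ζ : A), PresentedMonoid.mk D.SRel (yWord A z * aWord Y ξ) =
      PresentedMonoid.mk D.SRel (yWord A z * aWord Y ζ) → ξ = ζ) : D.Cond T := by
  refine ⟨fun v a => hc (h v) _ _ ?_, fun o => hc _ _ _ (T.mk_eq h_lt o)⟩
  -- In `G`: `h_v (v) a^v = v a^v = a v = a h_v (v) = h_v a^{h_v} (v)`.
  rw [map_mul, map_mul, mk_aWord_mul, mk_aWord_mul, ← mul_assoc, ← mul_assoc, ← mk_relator,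
    ← mk_aWord_mul_yWord, ← mk_aWord_mul_yWord, mul_assoc, ← mk_relator]

/-- Every word in `Y` is congruent to an `R`-irreducible one, up to an element of `A`. -/
theorem exists_irreducible (h_lt : ∀ v : Ω, DegLexLT rY (h v) v) (z : FreeMonoid Y) :
    ∃ (n : FreeMonoid Y) (α : A), PresentedMonoid.mk D.SRel (yWord A z) =
      PresentedMonoid.mk D.SRel (yWord A n * aWord Y α) ∧
      ∀ (v : Ω) (a b : FreeMonoid Y), n ≠ a * v * b := by
  have hY := isMonomialOrder_degLexLT rY
  -- Take the least word representing `z` up to `A`; a relator left inside it could be replaced to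
  -- give a smaller one.
  obtain ⟨n, ⟨α, hn⟩, hmin⟩ := hY.wf.has_min
    {n | ∃ α : A, PresentedMonoid.mk D.SRel (yWord A z) =
      PresentedMonoid.mk D.SRel (yWord A n * aWord Y α)} ⟨z, 1, by simp [aWord_one]⟩
  refine ⟨n, α, hn, ?_⟩
  rintro v a b rfl
  exact hmin (a * h v * b) ⟨_, hn.trans (D.rewrites_context v a b α).mk_eq⟩
    (hY.mul_mul a b (h_lt v))

/-- Since `z β = n α β` in `G` with `n` irreducible for `R`, and the words `n a` are irreducible for
`S`, equality in `G` becomes equality of words. -/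
theorem cancel_of_isGSB (h_lt : ∀ v : Ω, DegLexLT rY (h v) v)
    (hS : IsGSB (TowerLT rA rY) (binomials k D.SRel)) (z : FreeMonoid Y) (ξ ζ : A)
    (hz : PresentedMonoid.mk D.SRel (yWord A z * aWord Y ξ) =
      PresentedMonoid.mk D.SRel (yWord A z * aWord Y ζ)) : ξ = ζ := by
  obtain ⟨n, α, hn, hirr⟩ := D.exists_irreducible h_lt z
  have irr (β : A) (p) : ¬ RewriteStep D.SRel (yWord A n * aWord Y β) p := by
    rintro ⟨u, v, a, b, huv, he, -⟩
    cases huv with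
    | mul a₁ a₂ =>
      simp only [mul_assoc] at he
      have := eq_one_of_yWord_mul_aWord_eq he
      simpa using congrArg FreeMonoid.length this
    | factor v =>
      have := congrArg (fun u => yPart (FreeMonoid.toList u)) he
      simp only [FreeMonoid.toList_mul, yPart_append, yPart_yWord, yPart_aWord,
        List.append_nil] at this
      exact hirr v (FreeMonoid.ofList (yPart a.toList)) (FreeMonoid.ofList (yPart b.toList)) this
    | comm a₁ y =>
      simp only [mul_assoc] at he
      have := eq_one_of_yWord_mul_aWord_eq he
      simpa using congrArg FreeMonoid.length this
  have hnf (β : A) : PresentedMonoid.mk D.SRel (yWord A z * aWord Y β) =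
      PresentedMonoid.mk D.SRel (yWord A n * aWord Y (α * β)) := by
    rw [map_mul, hn, map_mul, map_mul, mul_assoc, ← mk_aWord_mul]
  rw [hnf, hnf] at hz
  have := hS.eq_of_mk_eq (isMonomialOrder_towerLT rA rY) (SRel.lt D h_lt) (irr _) (irr _) hz
  exact mul_left_cancel (aWord_injective (mul_left_cancel this))

theorem cond_of_isGSB (h_lt : ∀ v : Ω, DegLexLT rY (h v) v) (T : D.XiZeta k rA rY)
    (hS : IsGSB (TowerLT rA rY) (binomials k D.SRel)) : D.Cond T :=
  D.cond_of_cancel h_lt T (D.cancel_of_isGSB h_lt hS)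

/-! ### The conditions imply that `S` is a Gröbner–Shirshov basis -/

/-- Rewriting `a v` at `v` first ends in `h_v a^{h_v} (v)`; moving `a` through `v` first ends in
`h_v (v) a^v`. The first half of `(*)` identifies the two. -/
theorem isTrivialMod_comm_factor (h_lt : ∀ v : Ω, DegLexLT rY (h v) v)
    (hcond : ∀ (v : Ω) (a : A), D.factor v * D.pow a v = D.pow a (h v) * D.factor v)
    (a : NonOne A) (y : Y) (v : Ω) (q : FreeMonoid Y) (hv : (v : FreeMonoid Y) = .of y * q) :
    IsTrivialMod (TowerLT rA rY) (binomials k D.SRel)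
      (FreeMonoid.of (Sum.inl a) * yWord A (v : FreeMonoid Y))
      (mono k (FreeMonoid.of (Sum.inl a) * (yWord A (h v) * aWord Y (D.factor v))) -
        mono k (FreeMonoid.of (Sum.inr y) * aWord Y (D.act y a.1) * yWord A q)) := by
  have hr := isMonomialOrder_towerLT rA rY
  refine isTrivialMod_of_join hr (SRel.lt D h_lt)
    (p := yWord A (h v) * aWord Y (D.factor v * D.pow a.1 v)) ?_ ?_
    (hr.mul_left _ (SRel.lt D h_lt (.factor v))) ?_
  · rw [hcond, ← aWord_coe]
    have h1 := (D.rewrites_push a.1 (h v)).mul_right (aWord Y (D.factor v))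
    have h2 := (D.rewrites_mul (D.pow a.1 (h v)) (D.factor v)).mul_left (yWord A (h v))
    simp only [mul_assoc] at h1 h2 ⊢
    exact h1.trans h2
  · have h1 := (D.rewrites_push (D.act y a.1) q).mul_left (FreeMonoid.of (Sum.inr y))
    have h2 := (D.rewrites_factor v).mul_right (aWord Y (D.pow a.1 v))
    have h3 := (D.rewrites_mul (D.factor v) (D.pow a.1 v)).mul_left (yWord A (h v))
    have hpow : D.pow a.1 v = D.pow (D.act y a.1) q := by rw [hv, pow_mul, pow_of]
    rw [hv, yWord_mul, yWord_of, ← hv, hpow] at h2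
    rw [hpow] at h3 ⊢
    simp only [mul_assoc] at h1 h2 h3 ⊢
    exact (h1.trans h2).trans h3
  · rw [hv, yWord_mul, yWord_of, ← mul_assoc]
    exact hr.mul_right _ (SRel.lt D h_lt (.comm a y))

theorem isGSB_of_cond (h_lt : ∀ v : Ω, DegLexLT rY (h v) v)
    (h_min : ∀ v v' : Ω, v ≠ v' →
      ¬ ∃ a b : FreeMonoid Y, (v' : FreeMonoid Y) = a * v * b)
    (T : D.XiZeta k rA rY) (hT : D.Cond T) :
    IsGSB (TowerLT rA rY) (binomials k D.SRel) := by
  have hr := isMonomialOrder_towerLT rA rY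
  have hrel {u v} (huv : D.SRel u v) : TowerLT rA rY v u := SRel.lt D h_lt huv
  refine ⟨?_, ?_, ?_⟩
  · rintro f ⟨u, v, huv, rfl⟩
    exact ⟨u, isLeadingWord_binomial (hr.ne (hrel huv)) (hrel huv)⟩
  · rintro f ⟨u₁, t₁, h₁, rfl⟩ g ⟨u₂, t₂, h₂, rfl⟩ u v hu hv w a b rfl he hl
    rw [isLeadingWord_binomial_iff hr (hrel h₁)] at hu
    rw [isLeadingWord_binomial_iff hr (hrel h₂)] at hv
    subst hu hv
    have e : (mono k u - mono k t₁) * mono k b - mono k a * (mono k v - mono k t₂) =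
        mono k (a * t₂) - mono k (t₁ * b) := by
      rw [sub_mul, mul_sub, ← mono_mul, ← mono_mul, ← mono_mul, ← mono_mul, he]
      abel
    have join {p} (hp₂ : Rewrites D.SRel (a * t₂) p) (hp₁ : Rewrites D.SRel (t₁ * b) p) :
        IsTrivialMod (TowerLT rA rY) (binomials k D.SRel) (u * b)
          (mono k (a * t₂) - mono k (t₁ * b)) :=
      isTrivialMod_of_join hr hrel hp₂ hp₁ (he ▸ hr.mul_left a (hrel h₂))
        (hr.mul_right b (hrel h₁))
    obtain ⟨c, hc, e₁, e₂⟩ := FreeMonoid.overlap_of_mul_eq_mul he hl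
    rw [e]
    cases h₁ with
    | mul a₁ a₂ =>
      cases h₂ with
      | mul a₃ a₄ =>
        rcases FreeMonoid.overlap_of_mul_of hc e₁ e₂ with ⟨rfl, rfl, h13, h24⟩ | ⟨rfl, rfl, h23⟩
        · obtain rfl := Sum.inl_injective h13
          obtain rfl := Sum.inl_injective h24
          simpa using IsTrivialMod.zero
        · obtain rfl := Sum.inl_injective h23
          -- The critical pair on `a a' a''` is resolved by associativity in `A`.
          refine join (p := aWord Y (a₁.1 * (a₂.1 * a₄.1))) ?_ ?_
          · rw [← aWord_coe]
            exact D.rewrites_mul _ _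
          · rw [← aWord_coe, ← mul_assoc]
            exact D.rewrites_mul _ _
      | factor v =>
        obtain ⟨c', _, _, rfl, _⟩ := yWord_eq_mul e₂
        rcases FreeMonoid.of_mul_of_eq_mul e₁ with ⟨_, h2⟩ | ⟨_, h2⟩ | ⟨_, h2⟩
        · exact absurd (by rw [h2]; simp [FreeMonoid.mem_mul]) (inl_notMem_yWord a₁ c')
        · exact absurd (by rw [h2]; simp) (inl_notMem_yWord a₂ c')
        · exact absurd h2 hc
      | comm a₃ y =>
        rcases FreeMonoid.overlap_of_mul_of hc e₁ e₂ with ⟨_, _, _, h24⟩ | ⟨rfl, rfl, h23⟩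
        · cases h24
        · obtain rfl := Sum.inl_injective h23
          refine join (p := FreeMonoid.of (Sum.inr y) * aWord Y (D.act y (a₁.1 * a₂.1))) ?_
            (D.rewrites_comm _ _)
          rw [← aWord_coe, map_mul]
          have h1 := (D.rewrites_comm a₁.1 y).mul_right (aWord Y (D.act y a₂.1))
          have h2 := (D.rewrites_mul (D.act y a₁.1) (D.act y a₂.1)).mul_left
            (FreeMonoid.of (Sum.inr y))
          simp only [mul_assoc] at h1 h2 ⊢
          exact h1.trans h2
    | factor v₁ =>
      obtain ⟨d, c', hv₁, rfl, rfl⟩ := yWord_eq_mul e₁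
      have not_two {x} (a₁ : NonOne A)
          (h2 : FreeMonoid.of (Sum.inl a₁) * FreeMonoid.of x = yWord A c' * b) : False := by
        rcases FreeMonoid.of_mul_of_eq_mul h2 with ⟨h3, _⟩ | ⟨h3, _⟩ | ⟨h3, _⟩
        · exact hc h3
        · exact absurd (by rw [h3]; simp) (inl_notMem_yWord a₁ c')
        · exact absurd (by rw [h3]; simp [FreeMonoid.mem_mul]) (inl_notMem_yWord a₁ c')
      cases h₂ with
      | mul a₃ a₄ => exact (not_two a₃ e₂).elim
      | comm a₃ y => exact (not_two a₃ e₂).elim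
      | factor v₂ =>
        obtain ⟨c'', q, hv₂, hcc, rfl⟩ := yWord_eq_mul e₂
        obtain rfl := yWord_injective hcc
        have hcpos : 0 < c'.length := Nat.pos_of_ne_zero fun h0 =>
          hc (by rw [FreeMonoid.length_eq_zero.1 h0, yWord_one])
        let o : Overlap Ω := ⟨v₁, v₂, q, d, by rw [hv₁, hv₂, mul_assoc], by
          simp only [hv₁, hv₂, FreeMonoid.length_mul]
          omega⟩
        -- Here the second half of `(*)` enters: with `ξ = ζ` the correction term vanishes, and the
        -- composition itself is trivial.
        have := T.comp o
        rw [hT.2 o, sub_self, mul_zero, sub_zero, comp_eq] at this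
        simpa only [o, Overlap.w, yWord_mul, mul_assoc] using this
    | comm a₁ y =>
      cases h₂ with
      | mul a₃ a₄ =>
        rcases FreeMonoid.overlap_of_mul_of hc e₁ e₂ with ⟨_, _, _, h24⟩ | ⟨_, _, h23⟩
        · cases h24
        · cases h23
      | comm a₃ y' =>
        rcases FreeMonoid.overlap_of_mul_of hc e₁ e₂ with ⟨rfl, rfl, h13, h24⟩ | ⟨_, _, h23⟩
        · obtain rfl := Sum.inl_injective h13
          obtain rfl := Sum.inr_injective h24
          simpa using IsTrivialMod.zero
        · cases h23
      | factor v =>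
        obtain ⟨c', q, hv, rfl, rfl⟩ := yWord_eq_mul e₂
        rcases FreeMonoid.of_mul_of_eq_mul e₁ with ⟨_, h2⟩ | ⟨rfl, h2⟩ | ⟨_, h2⟩
        · exact absurd (by rw [h2]; simp [FreeMonoid.mem_mul]) (inl_notMem_yWord a₁ c')
        · obtain rfl : c' = FreeMonoid.of y := yWord_injective h2
          rw [he]
          exact D.isTrivialMod_comm_factor h_lt hT.1 a₁ y v q hv
        · exact absurd h2 hc
  · rintro f ⟨u₁, t₁, h₁, rfl⟩ g ⟨u₂, t₂, h₂, rfl⟩ u v hu hv a b he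
    rw [isLeadingWord_binomial_iff hr (hrel h₁)] at hu
    rw [isLeadingWord_binomial_iff hr (hrel h₂)] at hv
    subst hu hv
    have e : (mono k u - mono k t₁) - mono k a * (mono k v - mono k t₂) * mono k b =
        mono k (a * t₂ * b) - mono k t₁ := by
      rw [mono_mul_binomial_mul, ← he]
      abel
    rw [e]
    cases h₁ with
    | mul a₁ a₂ =>
      cases h₂ with
      | mul a₃ a₄ =>
        obtain ⟨rfl, rfl⟩ := FreeMonoid.eq_one_of_length_eq he rfl
        rw [one_mul, mul_one] at he
        obtain ⟨h13, h24⟩ := FreeMonoid.of_mul_of_inj he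
        obtain rfl := Sum.inl_injective h13
        obtain rfl := Sum.inl_injective h24
        simpa using IsTrivialMod.zero
      | factor v =>
        obtain ⟨y, hy⟩ := inr_mem_yWord (A := A) (relator_ne_one h_lt v)
        have : Sum.inr y ∈ a * yWord A (v : FreeMonoid Y) * b := by simp [FreeMonoid.mem_mul, hy]
        rw [← he] at this
        simp [FreeMonoid.mem_mul] at this
      | comm a₃ y =>
        obtain ⟨rfl, rfl⟩ := FreeMonoid.eq_one_of_length_eq he rfl
        rw [one_mul, mul_one] at he
        cases (FreeMonoid.of_mul_of_inj he).2
    | factor v₁ =>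
      cases h₂ with
      | mul a₃ a₄ =>
        exact absurd (by rw [he]; simp [FreeMonoid.mem_mul]) (inl_notMem_yWord a₃ v₁.1)
      | comm a₃ y =>
        exact absurd (by rw [he]; simp [FreeMonoid.mem_mul]) (inl_notMem_yWord a₃ v₁.1)
      | factor v₂ =>
        obtain ⟨p, b', hv, hp, rfl⟩ := yWord_eq_mul he
        obtain ⟨a', v', rfl, rfl, hv'⟩ := yWord_eq_mul hp.symm
        obtain rfl := yWord_injective hv'
        obtain rfl : v₂ = v₁ := by
          by_contra hne
          exact h_min v₂ v₁ hne ⟨a', b', hv⟩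
        obtain ⟨rfl, rfl⟩ := FreeMonoid.eq_one_of_length_eq hv rfl
        simpa [yWord_one] using IsTrivialMod.zero
    | comm a₁ y =>
      cases h₂ with
      | mul a₃ a₄ =>
        obtain ⟨rfl, rfl⟩ := FreeMonoid.eq_one_of_length_eq he rfl
        rw [one_mul, mul_one] at he
        cases (FreeMonoid.of_mul_of_inj he).2
      | comm a₃ y' =>
        obtain ⟨rfl, rfl⟩ := FreeMonoid.eq_one_of_length_eq he rfl
        rw [one_mul, mul_one] at he
        obtain ⟨h13, h24⟩ := FreeMonoid.of_mul_of_inj he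
        obtain rfl := Sum.inl_injective h13
        obtain rfl := Sum.inr_injective h24
        simpa using IsTrivialMod.zero
      | factor v =>
        have hv1 : yWord A (v : FreeMonoid Y) ≠ 1 := fun h1 =>
          relator_ne_one h_lt v (yWord_injective (h1.trans yWord_one.symm))
        rw [mul_assoc] at he
        rcases FreeMonoid.of_mul_of_eq_mul he with ⟨_, h2⟩ | ⟨rfl, h2⟩ | ⟨_, h2⟩
        · rcases FreeMonoid.of_mul_of_eq_mul h2.symm with ⟨h3, _⟩ | ⟨h3, _⟩ | ⟨h3, _⟩
          · exact absurd h3 hv1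
          · exact absurd (by rw [h3]; simp) (inl_notMem_yWord a₁ v.1)
          · exact absurd (by rw [h3]; simp [FreeMonoid.mem_mul]) (inl_notMem_yWord a₁ v.1)
        · rcases FreeMonoid.of_eq_mul h2.symm with ⟨h3, _⟩ | ⟨h3, rfl⟩
          · exact absurd h3 hv1
          -- A one-letter relator `y` is a subword of the leading word `a y`. Minimality compares
          -- relators only with each other and does not exclude this; it is the critical pair on `a
          -- v` with empty remainder `q`.
          · have hv : (v : FreeMonoid Y) = FreeMonoid.of y := yWord_injective h3
            have := D.isTrivialMod_comm_factor (rA := rA) (k := k) h_lt hT.1 a₁ y v 1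
              (by rw [hv, mul_one])
            rw [he]
            simpa [yWord_one] using this
        · exact absurd (congrArg FreeMonoid.length h2) (by
            rw [FreeMonoid.length_mul, FreeMonoid.length_one]
            intro h0
            exact hv1 (FreeMonoid.length_eq_zero.1 (by omega)))

end ExtData

/-! ### `G` as an extension of `A` by `B` -/

namespace ExtData

section Extension

variable {A B Y : Type*} [Group A] [Group B] {inv : Y → Option Y}
  {Ω : Set (FreeMonoid Y)} {h : Ω → FreeMonoid Y} (D : ExtData A inv Ω h)

/-- The homomorphism `A → G`. -/
noncomputable def inlHom : A →* D.E where
  toFun a := PresentedMonoid.mk D.SRel (aWord Y a)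
  map_one' := by rw [aWord_one, map_one]
  map_mul' := D.mk_aWord_mul

theorem inlHom_apply (a : A) : D.inlHom a = PresentedMonoid.mk D.SRel (aWord Y a) := rfl

/-- The canonical map from words in `Y` to `G`. -/
def yHom : FreeMonoid Y →* D.E :=
  (PresentedMonoid.mk D.SRel).comp (FreeMonoid.map Sum.inr)

theorem inlHom_mul_yHom (a : A) (u : FreeMonoid Y) :
    D.inlHom a * D.yHom u = D.yHom u * D.inlHom (D.pow a u) :=
  D.mk_aWord_mul_yWord a u

theorem yHom_relator (v : Ω) : D.yHom v = D.yHom (h v) * D.inlHom (D.factor v) :=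
  D.mk_relator v

theorem exists_eq_yHom_mul_inlHom (g : D.E) : ∃ u a, g = D.yHom u * D.inlHom a := by
  induction g using PresentedMonoid.inductionOn with
  | h m =>
    induction m using FreeMonoid.inductionOn' with
    | one => exact ⟨1, 1, by simp⟩
    | of_mul x m ih =>
      obtain ⟨u, a, hm⟩ := ih
      rw [map_mul, hm]
      cases x with
      | inl b =>
        refine ⟨u, D.pow b.1 u * a, ?_⟩
        rw [map_mul, ← mul_assoc, ← mul_assoc, ← inlHom_mul_yHom, inlHom_apply D b.1, aWord_coe]
      | inr y => exact ⟨FreeMonoid.of y * u, a, by rw [map_mul, mul_assoc]; rfl⟩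

/-- Words in `Y` that are equal in `B` are equal in `G` up to an element of `A`. -/
theorem exists_yHom_eq {u u' : FreeMonoid Y}
    (hu : PresentedMonoid.mk (RRel Ω h) u = PresentedMonoid.mk (RRel Ω h) u') :
    ∃ α, D.yHom u = D.yHom u' * D.inlHom α := by
  let c : Con (FreeMonoid Y) :=
    { r := fun u u' => ∃ α, D.yHom u = D.yHom u' * D.inlHom α
      iseqv := by
        refine ⟨fun u => ⟨1, by simp⟩, ?_, ?_⟩
        · rintro u u' ⟨α, hα⟩
          exact ⟨α⁻¹, by rw [hα, mul_assoc, ← map_mul, mul_inv_cancel, map_one, mul_one]⟩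
        · rintro u u' u'' ⟨α, hα⟩ ⟨β, hβ⟩
          exact ⟨β * α, by rw [hα, hβ, map_mul, mul_assoc]⟩
      mul' := by
        rintro u u' t t' ⟨α, hα⟩ ⟨β, hβ⟩
        refine ⟨D.pow α t' * β, ?_⟩
        rw [map_mul, map_mul, map_mul, hα, hβ, mul_assoc, ← mul_assoc (D.inlHom α),
          inlHom_mul_yHom]
        simp only [mul_assoc] }
  have hle : conGen (RRel Ω h) ≤ c := Con.conGen_le.2 (by
    rintro _ _ ⟨v, rfl, rfl⟩
    exact ⟨_, D.yHom_relator v⟩)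
  exact hle (PresentedMonoid.mk_eq_mk_iff.1 hu)

variable (e : PresentedMonoid (RRel Ω h) ≃* B)

/-- The projection `G → B`. -/
def rightHom : D.E →* B :=
  PresentedMonoid.lift (Sum.elim (fun _ => 1) fun y => e (PresentedMonoid.of _ y)) (by
    have hY (u : FreeMonoid Y) : FreeMonoid.lift (Sum.elim (fun _ : NonOne A => (1 : B))
        fun y => e (PresentedMonoid.of (RRel Ω h) y)) (yWord A u) =
          e (PresentedMonoid.mk _ u) := by
      induction u using FreeMonoid.inductionOn' with
      | one => simp [yWord_one]
      | of_mul y u ih => rw [yWord_mul, map_mul, ih, map_mul, map_mul]; rfl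
    have hA (a : A) : FreeMonoid.lift (Sum.elim (fun _ : NonOne A => (1 : B))
        fun y => e (PresentedMonoid.of (RRel Ω h) y)) (aWord Y a) = 1 := by
      by_cases ha : a = 1
      · rw [ha, aWord_one, map_one]
      · rw [aWord_of_ne ha]
        rfl
    intro u v huv
    cases huv with
    | mul a a' => rw [hA, ← aWord_coe, ← aWord_coe, map_mul, hA, hA, mul_one]
    | factor v =>
      rw [map_mul, hA, hY, hY, mul_one, PresentedMonoid.mk_eq_mk_of_rel ⟨v, rfl, rfl⟩]
    | comm a y => rw [map_mul, map_mul, hA, ← aWord_coe, hA, one_mul, mul_one])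

theorem rightHom_yHom (u : FreeMonoid Y) :
    D.rightHom e (D.yHom u) = e (PresentedMonoid.mk _ u) := by
  induction u using FreeMonoid.inductionOn' with
  | one => simp
  | of_mul y u ih => rw [map_mul, map_mul, ih, map_mul, map_mul]; rfl

theorem rightHom_inlHom (a : A) : D.rightHom e (D.inlHom a) = 1 := by
  by_cases ha : a = 1
  · rw [ha, map_one, map_one]
  · rw [inlHom_apply, aWord_of_ne ha]
    rfl

theorem rightHom_surjective : Function.Surjective (D.rightHom e) := by
  intro b
  obtain ⟨u, hu⟩ := PresentedMonoid.surjective_mk (e.symm b)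
  exact ⟨D.yHom u, by rw [rightHom_yHom, hu, e.apply_symm_apply]⟩

/-- Write `g = u a`; then `u` is trivial in `B`, so it agrees in `G` with an element of `A`. Neither
`(*)` nor a Gröbner–Shirshov basis is involved. -/
theorem exists_eq_inlHom_of_rightHom_eq_one {g : D.E} (hg : D.rightHom e g = 1) :
    ∃ a, g = D.inlHom a := by
  obtain ⟨u, a, rfl⟩ := D.exists_eq_yHom_mul_inlHom g
  rw [map_mul, rightHom_yHom, rightHom_inlHom, mul_one, ← map_one e, e.injective.eq_iff,
    ← map_one (PresentedMonoid.mk _)] at hg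
  obtain ⟨α, hα⟩ := D.exists_yHom_eq hg
  exact ⟨α * a, by rw [hα, map_one, one_mul, map_mul]⟩

/-- If `g'` lifts the inverse of the image of `g` in `B`, then `g g'` and `g' g` lie in the image of
`A`, hence are units; this provides one-sided inverses on both sides. -/
theorem isUnit_E (e : PresentedMonoid (RRel Ω h) ≃* B) (g : D.E) : IsUnit g := by
  obtain ⟨g', hg'⟩ := D.rightHom_surjective e (D.rightHom e g)⁻¹
  obtain ⟨a, ha⟩ := D.exists_eq_inlHom_of_rightHom_eq_one e (g := g * g') (by simp [hg'])
  obtain ⟨b, hb⟩ := D.exists_eq_inlHom_of_rightHom_eq_one e (g := g' * g) (by simp [hg'])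
  have h1 : g * (g' * D.inlHom a⁻¹) = 1 := by
    rw [← mul_assoc, ha, ← map_mul, mul_inv_cancel, map_one]
  have h2 : (D.inlHom b⁻¹ * g') * g = 1 := by
    rw [mul_assoc, hb, ← map_mul, inv_mul_cancel, map_one]
  exact isUnit_iff_exists.2 ⟨_, h1, by rw [← left_inv_eq_right_inv h2 h1, h2]⟩

theorem isNaturalExtension_of_injective (hinj : Function.Injective D.inlHom) :
    D.IsNaturalExtension e := by
  refine ⟨D.isUnit_E e, ?_⟩
  let _ : Group D.E := groupOfIsUnit (D.isUnit_E e)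
  refine ⟨⟨D.inlHom, D.rightHom e, hinj, ?_, D.rightHom_surjective e⟩, fun a => rfl, fun y => rfl⟩
  ext g
  constructor
  · rintro ⟨a, rfl⟩
    exact D.rightHom_inlHom e a
  · intro hg
    obtain ⟨a, rfl⟩ := D.exists_eq_inlHom_of_rightHom_eq_one e hg
    exact ⟨a, rfl⟩

end Extension

theorem inlHom_injective_of_isGSB {k : Type*} [Field k] {A : Type*} [Group A] {Y : Type*}
    {inv : Y → Option Y} {Ω : Set (FreeMonoid Y)} {h : Ω → FreeMonoid Y} (D : ExtData A inv Ω h)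
    {rA : NonOne A → NonOne A → Prop} [IsWellOrder (NonOne A) rA]
    {rY : Y → Y → Prop} [IsWellOrder Y rY] (h_lt : ∀ v : Ω, DegLexLT rY (h v) v)
    (hS : IsGSB (TowerLT rA rY) (binomials k D.SRel)) : Function.Injective D.inlHom :=
  fun a b hab => D.cancel_of_isGSB h_lt hS 1 a b (by simpa [yWord_one, inlHom_apply] using hab)

end ExtData

/-- Transport of a group extension along an isomorphism of the middle group. -/
def GroupExtension.congrMiddle {A C E B : Type*} [Group A] [Group C] [Group E] [Group B]
    (S : GroupExtension A E B) (f : C ≃* E) : GroupExtension A C B where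
  inl := f.symm.toMonoidHom.comp S.inl
  rightHom := S.rightHom.comp f.toMonoidHom
  inl_injective := f.symm.injective.comp S.inl_injective
  range_inl_eq_ker_rightHom := by
    ext c
    have := SetLike.ext_iff.1 S.range_inl_eq_ker_rightHom (f c)
    simp only [MonoidHom.mem_range, MonoidHom.mem_ker] at this
    simp [MonoidHom.mem_ker, ← this, MulEquiv.symm_apply_eq]
  rightHom_surjective := S.rightHom_surjective.comp f.surjective

theorem ExtData.IsNaturalExtension.nonempty_groupExtension {A B C Y : Type*} [Group A] [Group B]
    [Group C] {inv : Y → Option Y} {Ω : Set (FreeMonoid Y)} {h : Ω → FreeMonoid Y}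
    {D : ExtData A inv Ω h} {e : PresentedMonoid (RRel Ω h) ≃* B} (hD : D.IsNaturalExtension e)
    (f : C ≃* D.E) : Nonempty (GroupExtension A C B) := by
  obtain ⟨hG, X, -⟩ := hD
  let _ : Group D.E := groupOfIsUnit hG
  exact ⟨X.congrMiddle f⟩

/-! ### Extension data of a given extension -/

namespace GroupExtension

variable {A B C Y : Type*} [Group A] [Group B] [Group C]

theorem exists_inl_eq (S : GroupExtension A C B) {c : C} (hc : S.rightHom c = 1) :
    ∃ a, S.inl a = c := by
  have : c ∈ S.inl.range := S.range_inl_eq_ker_rightHom ▸ hc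
  exact this

/-- Representatives in `C` of elements of `B` can be chosen so that those of formally inverse
letters that denote inverse elements are inverse to each other. -/
theorem exists_representatives (S : GroupExtension A C B) (rY : Y → Y → Prop)
    [IsWellOrder Y rY] (inv : Y → Option Y)
    (inv_symm : ∀ y y', inv y = some y' → inv y' = some y) (inv_ne : ∀ y, inv y ≠ some y)
    (b : Y → B) : ∃ s : Y → C, (∀ y, S.rightHom (s y) = b y) ∧
      ∀ y y', inv y = some y' → b y * b y' = 1 → s y * s y' = 1 := by
  classical
  choose σ hσ using fun y => S.rightHom_surjective (b y)
  -- In each inverse pair the larger letter receives the inverse of the representative chosen for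
  -- the smaller one.
  let s (y : Y) : C := if hy : ∃ y', inv y = some y' ∧ b y * b y' = 1 ∧ rY y' y
    then (σ hy.choose)⁻¹ else σ y
  have s_pos {y y'} (h1 : inv y = some y') (h2 : b y * b y' = 1) (h3 : rY y' y) :
      s y = (σ y')⁻¹ := by
    have hy : ∃ y', inv y = some y' ∧ b y * b y' = 1 ∧ rY y' y := ⟨y', h1, h2, h3⟩
    have hch : hy.choose = y' := Option.some_injective _ (hy.choose_spec.1.symm.trans h1)
    simp only [s, dif_pos hy, hch]
  have s_neg {y y'} (h1 : inv y = some y') (h3 : rY y y') : s y = σ y := by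
    refine dif_neg ?_
    rintro ⟨t, ht, -, hty⟩
    obtain rfl : t = y' := Option.some_injective _ (ht.symm.trans h1)
    exact _root_.asymm h3 hty
  refine ⟨s, fun y => ?_, fun y y' h1 h2 => ?_⟩
  · by_cases hy : ∃ y', inv y = some y' ∧ b y * b y' = 1 ∧ rY y' y
    · obtain ⟨y', h1, h2, h3⟩ := hy
      rw [s_pos h1 h2 h3, map_inv, hσ, inv_eq_of_mul_eq_one_left h2]
    · simp only [s, dif_neg hy, hσ]
  · have h2' : b y' * b y = 1 := mul_eq_one_iff_eq_inv.2 (eq_inv_of_mul_eq_one_right h2)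
    rcases trichotomous_of rY y y' with hlt | rfl | hlt
    · rw [s_neg h1 hlt, s_pos (inv_symm _ _ h1) h2' hlt, mul_inv_cancel]
    · exact absurd h1 (inv_ne y)
    · rw [s_pos h1 h2 hlt, s_neg (inv_symm _ _ h1) hlt, inv_mul_cancel]

/-- Every extension of `A` by `B` is isomorphic to `E(A, Y, a^y, (v))` for some extension data,
in which moreover elements of `A` can be cancelled. -/
theorem exists_extData (S : GroupExtension A C B) (rY : Y → Y → Prop)
    [IsWellOrder Y rY] (inv : Y → Option Y)
    (inv_symm : ∀ y y', inv y = some y' → inv y' = some y) (inv_ne : ∀ y, inv y ≠ some y)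
    {Ω : Set (FreeMonoid Y)} {h : Ω → FreeMonoid Y} (e : PresentedMonoid (RRel Ω h) ≃* B) :
    ∃ D : ExtData A inv Ω h,
      (∀ (z : FreeMonoid Y) (ξ ζ : A), PresentedMonoid.mk D.SRel (yWord A z * aWord Y ξ) =
        PresentedMonoid.mk D.SRel (yWord A z * aWord Y ζ) → ξ = ζ) ∧ Nonempty (C ≃* D.E) := by
  obtain ⟨s, hs, hs_inv⟩ := S.exists_representatives rY inv inv_symm inv_ne
    fun y => e (PresentedMonoid.of _ y)
  have hs' (u : FreeMonoid Y) :
      S.rightHom (FreeMonoid.lift s u) = e (PresentedMonoid.mk _ u) := by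
    induction u using FreeMonoid.inductionOn' with
    | one => simp
    | of_mul y u ih => rw [map_mul, map_mul, ih, FreeMonoid.lift_eval_of, hs, map_mul, map_mul]; rfl
  have hfac (v : Ω) : ∃ a, S.inl a =
      (FreeMonoid.lift s (h v))⁻¹ * FreeMonoid.lift s (v : FreeMonoid Y) := by
    refine S.exists_inl_eq ?_
    rw [map_mul, map_inv, hs', hs',
      PresentedMonoid.mk_eq_mk_of_rel (rels := RRel Ω h) ⟨v, rfl, rfl⟩, inv_mul_cancel]
  choose φ hφ using hfac
  let D : ExtData A inv Ω h :=
    -- Conjugating by the inverse gives `a^y = s(y)⁻¹ a s(y)`, which matches the convention `a y = y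
    -- a^y`.
    { act := fun y => S.conjAct (s y)⁻¹
      factor := φ
      factor_eq_one := by
        intro v y y' hy hv hh
        apply S.inl_injective
        rw [hφ, hh, hv, map_one, map_one, inv_one, one_mul, map_mul, FreeMonoid.lift_eval_of,
          FreeMonoid.lift_eval_of]
        refine hs_inv y y' hy ?_
        have := PresentedMonoid.mk_eq_mk_of_rel (rels := RRel Ω h) ⟨v, rfl, rfl⟩
        rw [hv, hh, map_one, map_mul] at this
        rw [← map_mul, ← map_one e]
        exact congrArg e this }
  let f : NonOne A ⊕ Y → C := Sum.elim (fun a => S.inl a.1) s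
  have fA (a : A) : FreeMonoid.lift f (aWord Y a) = S.inl a := by
    by_cases ha : a = 1
    · rw [ha, aWord_one, map_one, map_one]
    · rw [aWord_of_ne ha]
      rfl
  have fY (u : FreeMonoid Y) : FreeMonoid.lift f (yWord A u) = FreeMonoid.lift s u := by
    induction u using FreeMonoid.inductionOn' with
    | one => simp [yWord_one]
    | of_mul y u ih => rw [yWord_mul, map_mul, ih, map_mul]; rfl
  have f_rel (u v) (huv : D.SRel u v) : FreeMonoid.lift f u = FreeMonoid.lift f v := by
    cases huv with
    | mul a a' => rw [fA, map_mul, map_mul, ← aWord_coe, ← aWord_coe, fA, fA]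
    | factor v => rw [map_mul, fY, fY, fA, hφ, mul_inv_cancel_left]
    | comm a y =>
      rw [map_mul, map_mul, fA, ← aWord_coe, fA, S.inl_conjAct_comm]
      change S.inl a.1 * s y = s y * ((s y)⁻¹ * S.inl a.1 * (s y)⁻¹⁻¹)
      group
  let F : D.E →* C := PresentedMonoid.lift f f_rel
  have F_mk (m) : F (PresentedMonoid.mk _ m) = FreeMonoid.lift f m := rfl
  have F_right (g : D.E) : S.rightHom (F g) = D.rightHom e g := by
    obtain ⟨u, a, rfl⟩ := D.exists_eq_yHom_mul_inlHom g
    have : F (D.yHom u) = FreeMonoid.lift s u := fY u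
    rw [map_mul, map_mul, map_mul, D.rightHom_yHom, D.rightHom_inlHom, this, hs',
      ExtData.inlHom_apply, F_mk, fA, S.rightHom_inl]
  refine ⟨D, fun z ξ ζ hz => ?_, ⟨(MulEquiv.ofBijective F ⟨?_, fun c => ?_⟩).symm⟩⟩
  -- Cancellation takes place in the group `C`, into which `A` embeds.
  · have := congrArg F hz
    rw [F_mk, F_mk, map_mul, map_mul, fA, fA] at this
    exact S.inl_injective (mul_left_cancel this)
  -- `F` is compatible with the maps from `A` and to `B`, so its bijectivity is a short five lemma
  -- argument, using on the side of `G` only exactness of `A → G → B → 1`.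
  · let _ : Group D.E := groupOfIsUnit (D.isUnit_E e)
    refine (injective_iff_map_eq_one F).2 fun g hg => ?_
    obtain ⟨a, rfl⟩ := D.exists_eq_inlHom_of_rightHom_eq_one e (g := g) (by
      rw [← F_right, hg, map_one])
    rw [ExtData.inlHom_apply, F_mk, fA] at hg
    rw [S.inl_injective (hg.trans (map_one S.inl).symm), map_one]
  · obtain ⟨g, hg⟩ := D.rightHom_surjective e (S.rightHom c)
    obtain ⟨a, ha⟩ := S.exists_inl_eq (c := (F g)⁻¹ * c) (by
      rw [map_mul, map_inv, F_right, hg, inv_mul_cancel])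
    refine ⟨g * D.inlHom a, ?_⟩
    rw [map_mul, ExtData.inlHom_apply, F_mk, fA, ha, mul_inv_cancel_left]

end GroupExtension

/-! ### The theorem -/

theorem mainTheorem6
    {k : Type*} [Field k] {A B Y : Type*} [Group A] [Group B]
    (rA : NonOne A → NonOne A → Prop) [IsWellOrder (NonOne A) rA]
    (rY : Y → Y → Prop) [IsWellOrder Y rY]
    (inv : Y → Option Y)
    (inv_symm : ∀ y y', inv y = some y' → inv y' = some y)
    (inv_ne : ∀ y, inv y ≠ some y)
    (Ω : Set (FreeMonoid Y)) (h : Ω → FreeMonoid Y)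
    (h_lt : ∀ v : Ω, DegLexLT rY (h v) v)
    (h_gsb : IsGSB (DegLexLT rY) (binomials k (RRel Ω h)))
    (h_min : ∀ v v' : Ω, v ≠ v' →
      ¬ ∃ a b : FreeMonoid Y, (v' : FreeMonoid Y) = a * v * b)
    (e : PresentedMonoid (RRel Ω h) ≃* B) :
    -- the elements `ξ` and `ζ` exist
    (∀ D : ExtData A inv Ω h, Nonempty (D.XiZeta k rA rY)) ∧
    -- and, whichever are chosen, the following holds
    ∀ T : ∀ D : ExtData A inv Ω h, D.XiZeta k rA rY,
      (∀ D : ExtData A inv Ω h,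
        (IsGSB (TowerLT rA rY) (binomials k D.SRel) ↔ D.Cond (T D)) ∧
        (D.Cond (T D) → D.IsNaturalExtension e)) ∧
      ∀ (C : Type*) [Group C],
        Nonempty (GroupExtension A C B) ↔
          ∃ D : ExtData A inv Ω h, D.Cond (T D) ∧ Nonempty (C ≃* D.E) := by
  refine ⟨fun D => D.nonempty_xiZeta h_lt h_gsb, fun T => ?_⟩
  have natural (D : ExtData A inv Ω h) (hD : D.Cond (T D)) : D.IsNaturalExtension e :=
    D.isNaturalExtension_of_injective e
      (D.inlHom_injective_of_isGSB h_lt (D.isGSB_of_cond h_lt h_min (T D) hD))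
  refine ⟨fun D => ⟨⟨D.cond_of_isGSB h_lt (T D), D.isGSB_of_cond h_lt h_min (T D)⟩, natural D⟩,
    fun C _ => ⟨?_, ?_⟩⟩
  · rintro ⟨S⟩
    obtain ⟨D, hD, hC⟩ := S.exists_extData rY inv inv_symm inv_ne e
    -- Cancellation implies `(*)` for any `ξ` and `ζ`, so the data may be built without reference to
    -- the choice `T`.
    exact ⟨D, D.cond_of_cancel h_lt (T D) hD, hC⟩
  · rintro ⟨D, hD, ⟨f⟩⟩
    exact (natural D hD).nonempty_groupExtension f
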